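/- **Setting.** Let $n-r\ge 2$, $r\ge 0$, let $\mathbb R^{m}_{s}$ be $\mathbb R^m$ with $\langle x,x\rangle=\sum_{i\le m-s}x_i^2-\sum_{i>m-s}x_i^2$ (extended complex bilinearly), and let $Q^n_r$ be the projectivized light cone of $\mathbb R^{n+2}_{r+1}$. Let $U\subset\mathbb C$ be open, with coordinate $z$, and let $y=[Y]:U\to Q^n_r$ be a smooth spacelike isothermic surface with adapted coordinate $z$ and canonical lift $Y$: $\langle Y,Y\rangle=0$, $|dY|^2=|dz|^2$, and the conformal Hopf differential $\kappa$, defined by $Y_{zz}=-\frac s2Y+\kappa$ with $\kappa\perp Y_{z\bar z}$, is real-valued. Put $V=\mathrm{Span}\{Y,\mathrm{Re}\,Y_z,\mathrm{Im}\,Y_z,Y_{z\bar z}\}$; it does not depend on the lift, and $V^\perp$ is the conformal normal bundle. A *$c$-polar surface* of $y$ ($c\in\mathbb R$) is a smooth section $\psi$ of $V^\perp$ that is parallel for the induced connection and has $\langle\psi,\psi\rangle=c$; for $c=0$ one requires $\psi\neq0$ and the surface is $[\psi]$. It is *non-degenerate* where it is a spacelike immersion. For a non-zero real constant $\theta$,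 a spacelike immersion $y^*=[Y^*]$ into $Q^n_r$, with lift normalized by $\langle Y,Y^*\rangle=-1$, is a *$D^\theta$ Darboux transform* of $y$ if $Y^*_z=\frac\mu2Y^*+\theta\,(Y_{\bar z}+\frac{\bar\mu}2Y)$ for some complex function $\mu$. For surfaces $\psi$ in the space form $\{\langle x,x\rangle=c\}\subset\mathbb R^{n+2}_{r+1}$, $c\ne0$, isothermic surfaces and $D^\theta$-transforms are understood through the conformal embeddings $x\mapsto[(x,\sqrt c)]$ into the projectivized light cone of $\mathbb R^{n+3}_{r+2}$ if $c>0$, and $x\mapsto[(\sqrt{-c},x)]$ into that of $\mathbb R^{n+3}_{r+1}$ if $c<0$; for $c=0$ they refer to $[\psi]$ in $Q^n_r$. **Theorem.** Let $y^*=[Y^*]$ be a $D^\theta$-transform of $y=[Y]$ as above, let $\xi$ be the $V^\perp$-component of $Y^*$, and let $\psi$ be a non-degenerate $c$-polar surface of $y$. Put $$\psi^*=\psi+\langle\psi,\xi\rangle\,Y+\frac{2\langle\psi,\kappa\rangle}{\theta}\,Y^*\quad\text{on }U.$$ Then 1. $y^*$ is isothermic with adapted coordinate $z$, and $\psi^*$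 is a $c$-polar surface of $y^*$ on $U$. 2. $\psi^*$ is non-degenerate exactly where $\langle\psi,\xi\rangle\neq0$. 3. On the open set where $\psi^*$ is non-degenerate, $\psi$ is isothermic with adapted coordinate $z$ and $\psi^*$ is a $D^\theta$-transform of $\psi$, with the same $\theta$. In this sense the $c$-polar and the Darboux transforms commute. -/

import Mathlib

open scoped ContDiff

/-- The bilinear form of the pseudo-Euclidean space `ℝ^m_s` (the first `m - s` coordinates count
positively, the last `s` negatively), over `ℝ`, or over `ℂ` as its complex bilinear extension. -/
def pform {R : Type*} [CommRing R] {m : ℕ} (s : ℕ) (x y : Fin m → R) : R :=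
  ∑ i : Fin m, if (i : ℕ) + s < m then x i * y i else -(x i * y i)

/-- The inclusion `ℝ^m → ℂ^m`. -/
def cplx {m : ℕ} (x : Fin m → ℝ) : Fin m → ℂ := fun i => (x i : ℂ)

/-- The real part `ℂ^m → ℝ^m`. -/
def rePart {m : ℕ} (x : Fin m → ℂ) : Fin m → ℝ := fun i => (x i).re

/-- The imaginary part `ℂ^m → ℝ^m`. -/
def imPart {m : ℕ} (x : Fin m → ℂ) : Fin m → ℝ := fun i => (x i).im

/-- The Wirtinger derivative `∂/∂z = (∂/∂u - i ∂/∂v) / 2`, where `z = u + i v`. -/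
noncomputable def dz {m : ℕ} (F : ℂ → Fin m → ℂ) (z : ℂ) : Fin m → ℂ :=
  (1 / 2 : ℂ) • (fderiv ℝ F z 1 - Complex.I • fderiv ℝ F z Complex.I)

/-- The Wirtinger derivative `∂/∂z̄ = (∂/∂u + i ∂/∂v) / 2`. -/
noncomputable def dzbar {m : ℕ} (F : ℂ → Fin m → ℂ) (z : ℂ) : Fin m → ℂ :=
  (1 / 2 : ℂ) • (fderiv ℝ F z 1 + Complex.I • fderiv ℝ F z Complex.I)

/-- `Y_z`. -/
noncomputable def derZ {m : ℕ} (Y : ℂ → Fin m → ℝ) : ℂ → Fin m → ℂ := dz (fun w => cplx (Y w))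

/-- `Y_z̄`. -/
noncomputable def derZbar {m : ℕ} (Y : ℂ → Fin m → ℝ) : ℂ → Fin m → ℂ :=
  dzbar (fun w => cplx (Y w))

/-- `Y_zz`. -/
noncomputable def derZZ {m : ℕ} (Y : ℂ → Fin m → ℝ) : ℂ → Fin m → ℂ := dz (derZ Y)

/-- `Y_zz̄` (a quarter of the Laplacian, hence real). -/
noncomputable def derZZbar {m : ℕ} (Y : ℂ → Fin m → ℝ) : ℂ → Fin m → ℂ := dzbar (derZ Y)

/-- The Schwarzian derivative `s` of a canonical lift `Y`. It is the function with
`Y_zz + (s / 2) Y` orthogonal to `Y_zz̄`; recall that `⟨Y, Y_zz̄⟩ = - 1 / 2`. -/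
noncomputable def schwarzian {m : ℕ} (s : ℕ) (Y : ℂ → Fin m → ℝ) (z : ℂ) : ℂ :=
  4 * pform s (derZZ Y z) (derZZbar Y z)

/-- The conformal Hopf differential `κ` of a canonical lift `Y`: `Y_zz = - (s / 2) Y + κ`. -/
noncomputable def hopf {m : ℕ} (s : ℕ) (Y : ℂ → Fin m → ℝ) (z : ℂ) : Fin m → ℂ :=
  derZZ Y z + (schwarzian s Y z / 2) • cplx (Y z)

/-- The differential of `f` at `z` is injective and the induced metric is positive definite. For
a map `f` into the light cone without its vertex this says that `[f]` is a spacelike immersion. -/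
def IsSpacelikeImmersionAt {m : ℕ} (s : ℕ) (f : ℂ → Fin m → ℝ) (z : ℂ) : Prop :=
  ∀ v : ℂ, v ≠ 0 → 0 < pform s (fderiv ℝ f z v) (fderiv ℝ f z v)

/-- `[A] = [B]` on `U`: two lifts of the same map into the projectivized light cone. -/
def SameSurface {m : ℕ} (U : Set ℂ) (A B : ℂ → Fin m → ℝ) : Prop :=
  ∀ z ∈ U, ∃ t : ℝ, t ≠ 0 ∧ A z = t • B z

/-- `Y` is a canonical lift, with respect to the coordinate `z` on `U`, of a conformally
parametrized spacelike surface in the projectivized light cone of `ℝ^m_s`: it maps into the light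
cone without its vertex, and `|dY|² = |dz|²`. -/
structure IsCanonicalLift {m : ℕ} (s : ℕ) (U : Set ℂ) (Y : ℂ → Fin m → ℝ) : Prop where
  smooth : ContDiffOn ℝ ∞ Y U
  ne_zero : ∀ z ∈ U, Y z ≠ 0
  null : ∀ z ∈ U, pform s (Y z) (Y z) = 0
  metric : ∀ z ∈ U, ∀ v : ℂ, pform s (fderiv ℝ Y z v) (fderiv ℝ Y z v) = ‖v‖ ^ 2

/-- `Y` is the canonical lift of a spacelike isothermic surface with adapted coordinate `z`: its
conformal Hopf differential is real-valued. -/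
structure IsIsothermicLift {m : ℕ} (s : ℕ) (U : Set ℂ) (Y : ℂ → Fin m → ℝ) : Prop where
  canonical : IsCanonicalLift s U Y
  hopf_real : ∀ z ∈ U, imPart (hopf s Y z) = 0

/-- The fibre `V_z` of the conformal tangent bundle, `V = Span {Y, Re Y_z, Im Y_z, Y_zz̄}`. It is
the same for all smooth lifts `Y` of a surface. -/
noncomputable def confTangent {m : ℕ} (Y : ℂ → Fin m → ℝ) (z : ℂ) : Submodule ℝ (Fin m → ℝ) :=
  Submodule.span ℝ {Y z, rePart (derZ Y z), imPart (derZ Y z), rePart (derZZbar Y z)}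

/-- `x` lies in the fibre at `z` of the conformal normal bundle `V^⊥`. -/
def IsConfNormal {m : ℕ} (s : ℕ) (Y : ℂ → Fin m → ℝ) (z : ℂ) (x : Fin m → ℝ) : Prop :=
  ∀ w ∈ confTangent Y z, pform s x w = 0

/-- `x` is the `V^⊥`-component of the vector `W` at `z`. -/
def IsNormalComponent {m : ℕ} (s : ℕ) (Y : ℂ → Fin m → ℝ) (z : ℂ) (W x : Fin m → ℝ) : Prop :=
  IsConfNormal s Y z x ∧ W - x ∈ confTangent Y z

/-- `ψ` is a `c`-polar surface of the spacelike isothermic surface `[Y]` with adapted coordinate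
`z`, where `Y` is any smooth lift: `ψ` is a section of the conformal normal bundle, it is parallel
(`Dψ`, the `V^⊥`-component of `dψ`, vanishes), and `⟨ψ, ψ⟩ = c`. For `c = 0` the polar surface is
`[ψ]`, so that `ψ` must not vanish. -/
structure IsPolarSurface {m : ℕ} (s : ℕ) (U : Set ℂ) (Y : ℂ → Fin m → ℝ) (c : ℝ)
    (ψ : ℂ → Fin m → ℝ) : Prop where
  smooth_lift : ContDiffOn ℝ ∞ Y U
  isothermic : ∃ Y₀ : ℂ → Fin m → ℝ, SameSurface U Y₀ Y ∧ IsIsothermicLift s U Y₀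
  smooth : ContDiffOn ℝ ∞ ψ U
  normal : ∀ z ∈ U, IsConfNormal s Y z (ψ z)
  parallel : ∀ z ∈ U, ∀ v : ℂ, fderiv ℝ ψ z v ∈ confTangent Y z
  length : ∀ z ∈ U, pform s (ψ z) (ψ z) = c
  ne_zero : c = 0 → ∀ z ∈ U, ψ z ≠ 0

/-- `Y` is the canonical lift of a spacelike isothermic surface with adapted coordinate `z`, and
`Y'` is the lift with `⟨Y, Y'⟩ = -1` of a `D^θ`-transform `[Y']` of `[Y]`:
`Y'_z = (μ / 2) Y' + θ (Y_z̄ + (μ̄ / 2) Y)` with a non-zero real constant `θ`. -/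
structure IsDarbouxPair {m : ℕ} (s : ℕ) (U : Set ℂ) (θ : ℝ) (Y Y' : ℂ → Fin m → ℝ) : Prop where
  isothermic : IsIsothermicLift s U Y
  theta_ne_zero : θ ≠ 0
  smooth : ContDiffOn ℝ ∞ Y' U
  null : ∀ z ∈ U, pform s (Y' z) (Y' z) = 0
  immersion : ∀ z ∈ U, IsSpacelikeImmersionAt s Y' z
  normalized : ∀ z ∈ U, pform s (Y z) (Y' z) = -1
  derivative : ∃ μ : ℂ → ℂ, ∀ z ∈ U, derZ Y' z = (μ z / 2) • cplx (Y' z) +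
    (θ : ℂ) • (derZbar Y z + (starRingEnd ℂ (μ z) / 2) • cplx (Y z))

/-- The surface `[B]` is a `D^θ`-transform of the isothermic surface `[A]` (adapted coordinate
`z` on `U`, arbitrary lifts `A`, `B`). -/
def IsDarbouxTransform {m : ℕ} (s : ℕ) (U : Set ℂ) (θ : ℝ) (A B : ℂ → Fin m → ℝ) : Prop :=
  ∃ Y Y' : ℂ → Fin m → ℝ, SameSurface U Y A ∧ SameSurface U Y' B ∧ IsDarbouxPair s U θ Y Y'

/-- `D^θ`-transforms for maps `φ`, `φ'` with values in `{x ∈ ℝ^m_s | ⟨x, x⟩ = c}`. If `c = 0`, these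
are lifts of the surfaces `[φ]`, `[φ']` in the projectivized light cone of `ℝ^m_s`. If `c ≠ 0`, the
pseudo-Riemannian space form `{⟨x, x⟩ = c}` is conformally embedded in a projectivized light cone,
by `x ↦ [(x, √c)]` in `ℝ^{m+1}_{s+1}` for `c > 0`, and by `x ↦ [(√(-c), x)]` in `ℝ^{m+1}_s` for
`c < 0`. -/
def IsDarbouxTransformOfLength {m : ℕ} (s : ℕ) (U : Set ℂ) (θ c : ℝ) (φ φ' : ℂ → Fin m → ℝ) :
    Prop :=
  (c = 0 → IsDarbouxTransform s U θ φ φ') ∧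
  (0 < c → IsDarbouxTransform (s + 1) U θ
    (fun z => (Fin.snoc (φ z) (Real.sqrt c) : Fin (m + 1) → ℝ))
    (fun z => (Fin.snoc (φ' z) (Real.sqrt c) : Fin (m + 1) → ℝ))) ∧
  (c < 0 → IsDarbouxTransform s U θ
    (fun z => (Fin.cons (Real.sqrt (-c)) (φ z) : Fin (m + 1) → ℝ))
    (fun z => (Fin.cons (Real.sqrt (-c)) (φ' z) : Fin (m + 1) → ℝ)))

/-!
Write `y, y*` for the lifts `Y, Y*`, and let subscripts denote Wirtinger derivatives. The proof
works with complex inner products only, and needs neither a full moving frame of `V` nor the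
`V^⊥`-component of `Y*` beyond the observation that a section `ψ` of `V^⊥` satisfies
`⟨ψ, ξ⟩ = ⟨ψ, y*⟩`. Put `p = ⟨ψ, κ⟩ = ⟨ψ, y_zz⟩`, `q = ⟨ψ, y*⟩` and `μ = 2 ⟨y_z, y*⟩`; the functions
`p` and `q` are real, and `μ` is the function in the equation of the Darboux transform.

Everything follows from three first order equations:

* `ψ_z = 2 p_z̄ y - 2 p y_z̄` (`IsPolarSurface.derZ_eq`), so `ψ` is conformal with factor `4 p²`;
* `q_z = (μ / 2) q - μ̄ p - 2 p_z̄` (`IsDarbouxPair.wirt_pform_polar`);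
* `ψ*_z = (μ q / 2) y + q y_z + ((2 p_z + p μ) / θ) y*` (`IsDarbouxPair.derZ_polarTransform`).

By the equation of the Darboux transform, the last right-hand side is a combination of `y*` and
`(q / θ) y*_z̄`. Hence `ψ*` is a parallel normal section along `y*`
(`IsDarbouxPair.isPolarSurface_polarTransform`), and it is conformal with factor `q²`, so that it is
an immersion exactly where `q ≠ 0`.

A canonical lift is isothermic as soon as its second `z`-derivative is real up to a multiple of the
lift itself (`IsCanonicalLift.isIsothermicLift`). This applies to `y* / |θ|`, where the reality of
`μ_z̄` is used, and to the lift `Φ = Ψ / (2 p)` of `ψ`. Here `Ψ` is the image of `ψ` in a light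
cone; it differs from `ψ` only by a linear isometry and a constant vector of square `-c`, so the three
equations persist and the sign of `c` plays no further role. With `Φ* = -θ Ψ* / q` one has
`⟨Φ, Φ*⟩ = -1`, and eliminating `y*` from the equation for `ψ*_z` turns it into the Darboux equation
of the pair `Φ, Φ*`, with the same `θ` and with
`μ' / 2 = p_z / p + (μ̄ p + 2 p_z̄) / q` (`isDarbouxPair_of_polar`).
-/

/-! ### The bilinear form and complexification -/

section Form

variable {R : Type*} [CommRing R] {m : ℕ} (s : ℕ)

theorem pform_comm (x y : Fin m → R) : pform s x y = pform s y x := by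
  simp only [pform, mul_comm]

theorem pform_add_left (x y w : Fin m → R) :
    pform s (x + y) w = pform s x w + pform s y w := by
  simp only [pform, ← Finset.sum_add_distrib, Pi.add_apply]
  refine Finset.sum_congr rfl fun i _ => ?_
  split_ifs <;> ring

theorem pform_smul_left (a : R) (x w : Fin m → R) :
    pform s (a • x) w = a * pform s x w := by
  simp only [pform, Finset.mul_sum, Pi.smul_apply, smul_eq_mul]
  refine Finset.sum_congr rfl fun i _ => ?_
  split_ifs <;> ring

theorem pform_add_right (x y w : Fin m → R) :
    pform s w (x + y) = pform s w x + pform s w y := by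
  simp only [pform_comm s w, pform_add_left]

theorem pform_smul_right (a : R) (x w : Fin m → R) :
    pform s w (a • x) = a * pform s w x := by
  simp only [pform_comm s w, pform_smul_left]

theorem pform_neg_left (x w : Fin m → R) : pform s (-x) w = -pform s x w := by
  rw [← neg_one_smul R x, pform_smul_left, neg_one_mul]

theorem pform_neg_right (x w : Fin m → R) : pform s w (-x) = -pform s w x := by
  rw [pform_comm, pform_neg_left, pform_comm]

theorem pform_sub_left (x y w : Fin m → R) :
    pform s (x - y) w = pform s x w - pform s y w := by
  rw [sub_eq_add_neg, pform_add_left, pform_neg_left, sub_eq_add_neg]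

theorem pform_sub_right (x y w : Fin m → R) :
    pform s w (x - y) = pform s w x - pform s w y := by
  rw [sub_eq_add_neg, pform_add_right, pform_neg_right, sub_eq_add_neg]

theorem pform_zero_left (w : Fin m → R) : pform s 0 w = 0 := by
  simp [pform]

theorem pform_zero_right (w : Fin m → R) : pform s w 0 = 0 := by
  simp [pform]

end Form

section Complexification

variable {m : ℕ} (s : ℕ)

theorem cplx_add (x y : Fin m → ℝ) : cplx (x + y) = cplx x + cplx y := by
  ext i; simp [cplx]

theorem cplx_smul (a : ℝ) (x : Fin m → ℝ) : cplx (a • x) = (a : ℂ) • cplx x := by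
  ext i; simp [cplx]

theorem cplx_injective : Function.Injective (cplx (m := m)) := fun x y h => by
  ext i; exact Complex.ofReal_injective (congrFun h i)

theorem pform_cplx (x y : Fin m → ℝ) : pform s (cplx x) (cplx y) = ((pform s x y : ℝ) : ℂ) := by
  simp only [pform, cplx, Complex.ofReal_sum]
  refine Finset.sum_congr rfl fun i _ => ?_
  split_ifs <;> simp

theorem star_cplx (x : Fin m → ℝ) : star (cplx x) = cplx x := by
  ext i; simp [cplx]

theorem star_pform (x y : Fin m → ℂ) : star (pform s x y) = pform s (star x) (star y) := by
  simp only [pform, star_sum]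
  refine Finset.sum_congr rfl fun i _ => ?_
  split_ifs <;> simp

theorem imPart_eq_zero_iff {x : Fin m → ℂ} : imPart x = 0 ↔ star x = x := by
  constructor
  · intro h
    ext i
    exact Complex.conj_eq_iff_im.2 (congrFun h i)
  · intro h
    ext i
    exact Complex.conj_eq_iff_im.1 (congrFun h i)

theorem cplx_rePart (x : Fin m → ℂ) : cplx (rePart x) = (1 / 2 : ℂ) • (x + star x) := by
  ext i
  have := Complex.add_conj (x i)
  simp only [cplx, rePart, Pi.smul_apply, Pi.add_apply, Pi.star_apply, smul_eq_mul,
    Complex.star_def, this]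
  push_cast; ring

theorem cplx_imPart (x : Fin m → ℂ) :
    cplx (imPart x) = (-(Complex.I / 2) : ℂ) • (x - star x) := by
  ext i
  have := Complex.sub_conj (x i)
  simp only [cplx, imPart, Pi.smul_apply, Pi.sub_apply, Pi.star_apply, smul_eq_mul,
    Complex.star_def, this]
  push_cast
  linear_combination ((x i).im : ℂ) * Complex.I_mul_I

theorem cplx_rePart_of_star_eq {x : Fin m → ℂ} (h : star x = x) : cplx (rePart x) = x := by
  rw [cplx_rePart, h, ← two_smul ℂ x, smul_smul]; norm_num

end Complexification

/-! ### Wirtinger calculus -/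

section Wirtinger

variable {E : Type*} [NormedAddCommGroup E] [NormedSpace ℝ E] [NormedSpace ℂ E]
  {m : ℕ} {U : Set ℂ} {z : ℂ}

/-- The Wirtinger derivative `∂F/∂z` of a map into an arbitrary complex normed space; for maps into
`ℂ^m` it is `dz`, and the case of `ℂ`-valued functions is needed for product rules. -/
noncomputable def wirt (F : ℂ → E) (z : ℂ) : E :=
  (1 / 2 : ℂ) • (fderiv ℝ F z 1 - Complex.I • fderiv ℝ F z Complex.I)

/-- The Wirtinger derivative `∂F/∂z̄` of a map into an arbitrary complex normed space. -/
noncomputable def wirtBar (F : ℂ → E) (z : ℂ) : E :=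
  (1 / 2 : ℂ) • (fderiv ℝ F z 1 + Complex.I • fderiv ℝ F z Complex.I)

theorem wirt_congr {F G : ℂ → E} (hU : IsOpen U) (h : ∀ z ∈ U, F z = G z) (hz : z ∈ U) :
    wirt F z = wirt G z := by
  have : F =ᶠ[nhds z] G := Filter.eventuallyEq_of_mem (hU.mem_nhds hz) h
  simp only [wirt, this.fderiv_eq]

theorem wirtBar_congr {F G : ℂ → E} (hU : IsOpen U) (h : ∀ z ∈ U, F z = G z) (hz : z ∈ U) :
    wirtBar F z = wirtBar G z := by
  have : F =ᶠ[nhds z] G := Filter.eventuallyEq_of_mem (hU.mem_nhds hz) h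
  simp only [wirtBar, this.fderiv_eq]

theorem wirt_const (a : E) : wirt (fun _ => a) z = 0 := by simp [wirt]

theorem wirtBar_const (a : E) : wirtBar (fun _ => a) z = 0 := by simp [wirtBar]

theorem wirt_add {F G : ℂ → E} (hF : DifferentiableAt ℝ F z) (hG : DifferentiableAt ℝ G z) :
    wirt (fun w => F w + G w) z = wirt F z + wirt G z := by
  simp only [wirt, fderiv_fun_add hF hG, add_apply]
  module

theorem wirt_sub {F G : ℂ → E} (hF : DifferentiableAt ℝ F z) (hG : DifferentiableAt ℝ G z) :
    wirt (fun w => F w - G w) z = wirt F z - wirt G z := by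
  simp only [wirt, fderiv_fun_sub hF hG, sub_apply]
  module

theorem wirtBar_sub {F G : ℂ → E} (hF : DifferentiableAt ℝ F z) (hG : DifferentiableAt ℝ G z) :
    wirtBar (fun w => F w - G w) z = wirtBar F z - wirtBar G z := by
  simp only [wirtBar, fderiv_fun_sub hF hG, sub_apply]
  module

theorem wirt_smul [IsScalarTower ℝ ℂ E] {f : ℂ → ℂ} {F : ℂ → E} (hf : DifferentiableAt ℝ f z)
    (hF : DifferentiableAt ℝ F z) :
    wirt (fun w => f w • F w) z = wirt f z • F z + f z • wirt F z := by
  simp only [wirt, fderiv_fun_smul hf hF, add_apply,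
    smul_apply, ContinuousLinearMap.smulRight_apply, smul_eq_mul]
  module

theorem wirtBar_smul [IsScalarTower ℝ ℂ E] {f : ℂ → ℂ} {F : ℂ → E} (hf : DifferentiableAt ℝ f z)
    (hF : DifferentiableAt ℝ F z) :
    wirtBar (fun w => f w • F w) z = wirtBar f z • F z + f z • wirtBar F z := by
  simp only [wirtBar, fderiv_fun_smul hf hF, add_apply,
    smul_apply, ContinuousLinearMap.smulRight_apply, smul_eq_mul]
  module

theorem wirt_mul {f g : ℂ → ℂ} (hf : DifferentiableAt ℝ f z) (hg : DifferentiableAt ℝ g z) :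
    wirt (fun w => f w * g w) z = wirt f z * g z + f z * wirt g z :=
  wirt_smul hf hg

theorem wirtBar_mul {f g : ℂ → ℂ} (hf : DifferentiableAt ℝ f z) (hg : DifferentiableAt ℝ g z) :
    wirtBar (fun w => f w * g w) z = wirtBar f z * g z + f z * wirtBar g z :=
  wirtBar_smul hf hg

theorem wirt_clm {G : Type*} [NormedAddCommGroup G] [NormedSpace ℝ G] [NormedSpace ℂ G]
    [IsScalarTower ℝ ℂ E] [IsScalarTower ℝ ℂ G]
    (L : E →L[ℂ] G) {F : ℂ → E} (hF : DifferentiableAt ℝ F z) :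
    wirt (fun w => L (F w)) z = L (wirt F z) := by
  have : fderiv ℝ (fun w => L (F w)) z = (L.restrictScalars ℝ).comp (fderiv ℝ F z) :=
    ((L.restrictScalars ℝ).hasFDerivAt.comp z hF.hasFDerivAt).fderiv
  simp only [wirt, this, ContinuousLinearMap.comp_apply, ContinuousLinearMap.coe_restrictScalars',
    map_smul, map_sub]

theorem wirt_pi {F : ℂ → Fin m → ℂ} (hF : DifferentiableAt ℝ F z) (i : Fin m) :
    wirt (fun w => F w i) z = wirt F z i := by
  simp only [wirt, fderiv_apply hF, ContinuousLinearMap.comp_apply,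
    ContinuousLinearMap.proj_apply, Pi.smul_apply, Pi.sub_apply]

/-- The real differential in terms of the Wirtinger derivatives: `dF = F_z dz + F_z̄ dz̄`. -/
theorem fderiv_eq_wirt [IsScalarTower ℝ ℂ E] (F : ℂ → E) (z v : ℂ) :
    fderiv ℝ F z v = v • wirt F z + star v • wirtBar F z := by
  have hv : v = v.re • (1 : ℂ) + v.im • Complex.I := by
    simp [Complex.re_add_im]
  have h1 : fderiv ℝ F z v = v.re • fderiv ℝ F z 1 + v.im • fderiv ℝ F z Complex.I := by
    conv_lhs => rw [hv, map_add, map_smul, map_smul]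
  rw [h1, wirt, wirtBar]
  generalize fderiv ℝ F z 1 = a
  generalize fderiv ℝ F z Complex.I = b
  have ha : v.re • a = (v.re : ℂ) • a := (algebraMap_smul ℂ v.re a).symm
  have hb : v.im • b = (v.im : ℂ) • b := (algebraMap_smul ℂ v.im b).symm
  have e1 : v = v.re + v.im * Complex.I := (Complex.re_add_im v).symm
  have e2 : star v = v.re - v.im * Complex.I := by
    apply Complex.ext <;> simp
  rw [ha, hb]
  generalize hx : (v.re : ℂ) = x at *
  generalize hy : (v.im : ℂ) = y at *
  rw [e2, e1]
  have hI := Complex.I_mul_I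
  match_scalars
  · ring
  · linear_combination y * hI

theorem wirtBar_star [StarAddMonoid E] [NormedStarGroup E] [StarModule ℂ E] [StarModule ℝ E]
    (F : ℂ → E) (z : ℂ) : wirtBar (fun w => star (F w)) z = star (wirt F z) := by
  have h : fderiv ℝ (fun w => star (F w)) z
      = ((starL' ℝ : E ≃L[ℝ] E) : E →L[ℝ] E).comp (fderiv ℝ F z) :=
    (starL' ℝ : E ≃L[ℝ] E).comp_fderiv
  simp only [wirt, wirtBar, h, ContinuousLinearMap.comp_apply, star_smul, star_sub]
  simp [sub_eq_add_neg]

theorem wirt_star [StarAddMonoid E] [NormedStarGroup E] [StarModule ℂ E] [StarModule ℝ E]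
    (F : ℂ → E) (z : ℂ) : wirt (fun w => star (F w)) z = star (wirtBar F z) := by
  rw [← star_star (wirt (fun w => star (F w)) z), ← wirtBar_star]
  simp only [star_star]

theorem wirt_pform (s : ℕ) {F G : ℂ → Fin m → ℂ} (hF : DifferentiableAt ℝ F z)
    (hG : DifferentiableAt ℝ G z) :
    wirt (fun w => pform s (F w) (G w)) z
      = pform s (wirt F z) (G z) + pform s (F z) (wirt G z) := by
  have hF' := differentiableAt_pi.1 hF
  have hG' := differentiableAt_pi.1 hG
  have hi : ∀ i ∈ (Finset.univ : Finset (Fin m)), DifferentiableAt ℝ (fun w =>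
      if (i : ℕ) + s < m then F w i * G w i else -(F w i * G w i)) z := fun i _ => by
    split_ifs
    · exact (hF' i).mul (hG' i)
    · exact ((hF' i).mul (hG' i)).neg
  simp only [pform]
  have : wirt (fun w => ∑ i : Fin m, if (i : ℕ) + s < m then
      F w i * G w i else -(F w i * G w i)) z = ∑ i : Fin m, wirt (fun w => if (i : ℕ) + s < m then
      F w i * G w i else -(F w i * G w i)) z := by
    simp only [wirt, fderiv_fun_sum hi, sum_apply, Finset.smul_sum,
      ← Finset.sum_sub_distrib]
  rw [this, ← Finset.sum_add_distrib]
  refine Finset.sum_congr rfl fun i _ => ?_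
  split_ifs
  · rw [wirt_mul (hF' i) (hG' i), wirt_pi hF, wirt_pi hG]
  · have : ∀ f : ℂ → ℂ, wirt (fun w => -f w) z = -wirt f z := fun f => by
      simp only [wirt, fderiv_fun_neg, neg_apply]; module
    rw [this, wirt_mul (hF' i) (hG' i), wirt_pi hF, wirt_pi hG]
    ring

theorem wirtBar_pform (s : ℕ) {F G : ℂ → Fin m → ℂ} (hF : DifferentiableAt ℝ F z)
    (hG : DifferentiableAt ℝ G z) :
    wirtBar (fun w => pform s (F w) (G w)) z
      = pform s (wirtBar F z) (G z) + pform s (F z) (wirtBar G z) := by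
  have h := wirt_pform s (z := z) (F := fun w => star (F w)) (G := fun w => star (G w))
    hF.star hG.star
  simp only [← star_pform, wirt_star] at h
  have h' := congrArg star h
  rw [star_star, star_add, star_pform, star_pform] at h'
  simpa only [star_star] using h'

section Smooth

theorem ContDiffOn.differentiableAt_of_isOpen {G : Type*} [NormedAddCommGroup G]
    [NormedSpace ℝ G] {F : ℂ → G} (hF : ContDiffOn ℝ ∞ F U)
    (hU : IsOpen U) (hz : z ∈ U) : DifferentiableAt ℝ F z :=
  (hF.differentiableOn (by simp)).differentiableAt (hU.mem_nhds hz)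

theorem ContDiffOn.fderiv_apply_const {G : Type*} [NormedAddCommGroup G]
    [NormedSpace ℝ G] {F : ℂ → G} (hF : ContDiffOn ℝ ∞ F U) (hU : IsOpen U)
    (v : ℂ) : ContDiffOn ℝ ∞ (fun z => fderiv ℝ F z v) U :=
  (hF.fderiv_of_isOpen hU (m := ∞) (by simp)).clm_apply contDiffOn_const

theorem ContDiffOn.wirt [IsScalarTower ℝ ℂ E] {F : ℂ → E} (hF : ContDiffOn ℝ ∞ F U)
    (hU : IsOpen U) : ContDiffOn ℝ ∞ (wirt F) U :=
  ((hF.fderiv_apply_const hU 1).sub ((hF.fderiv_apply_const hU Complex.I).const_smul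
    Complex.I)).const_smul (1 / 2 : ℂ)

theorem ContDiffOn.wirtBar [IsScalarTower ℝ ℂ E] {F : ℂ → E} (hF : ContDiffOn ℝ ∞ F U)
    (hU : IsOpen U) : ContDiffOn ℝ ∞ (wirtBar F) U :=
  ((hF.fderiv_apply_const hU 1).add ((hF.fderiv_apply_const hU Complex.I).const_smul
    Complex.I)).const_smul (1 / 2 : ℂ)

theorem ContDiffOn.star {G : Type*} [NormedAddCommGroup G] [NormedSpace ℝ G] [StarAddMonoid G]
    [NormedStarGroup G] [StarModule ℝ G] {F : ℂ → G} (hF : ContDiffOn ℝ ∞ F U) :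
    ContDiffOn ℝ ∞ (fun w => star (F w)) U :=
  (starL' ℝ : G ≃L[ℝ] G).contDiff.comp_contDiffOn hF

theorem ContDiffOn.cplx {Y : ℂ → Fin m → ℝ} (hY : ContDiffOn ℝ ∞ Y U) :
    ContDiffOn ℝ ∞ (fun w => cplx (Y w)) U :=
  contDiffOn_pi.2 fun i => Complex.ofRealCLM.contDiff.comp_contDiffOn (contDiffOn_pi.1 hY i)

theorem ContDiffOn.ofReal {f : ℂ → ℝ} (hf : ContDiffOn ℝ ∞ f U) :
    ContDiffOn ℝ ∞ (fun w => (f w : ℂ)) U :=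
  Complex.ofRealCLM.contDiff.comp_contDiffOn hf

theorem ContDiffOn.pform_real (s : ℕ) {F G : ℂ → Fin m → ℝ} (hF : ContDiffOn ℝ ∞ F U)
    (hG : ContDiffOn ℝ ∞ G U) : ContDiffOn ℝ ∞ (fun w => pform s (F w) (G w)) U := by
  have hF' := contDiffOn_pi.1 hF
  have hG' := contDiffOn_pi.1 hG
  refine ContDiffOn.sum fun i _ => ?_
  split_ifs
  · exact (hF' i).mul (hG' i)
  · exact ((hF' i).mul (hG' i)).neg

theorem ContDiffOn.pform_complex (s : ℕ) {F G : ℂ → Fin m → ℂ} (hF : ContDiffOn ℝ ∞ F U)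
    (hG : ContDiffOn ℝ ∞ G U) : ContDiffOn ℝ ∞ (fun w => pform s (F w) (G w)) U := by
  have hF' := contDiffOn_pi.1 hF
  have hG' := contDiffOn_pi.1 hG
  refine ContDiffOn.sum fun i _ => ?_
  split_ifs
  · exact (hF' i).mul (hG' i)
  · exact ((hF' i).mul (hG' i)).neg

theorem wirtBar_wirt_comm [IsScalarTower ℝ ℂ E] {F : ℂ → E} (hF : ContDiffOn ℝ ∞ F U)
    (hU : IsOpen U) (hz : z ∈ U) : wirtBar (wirt F) z = wirt (wirtBar F) z := by
  have hFz : ContDiffAt ℝ ∞ F z := hF.contDiffAt (hU.mem_nhds hz)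
  have hsymm : IsSymmSndFDerivAt ℝ F z := hFz.isSymmSndFDerivAt
    (by simp only [minSmoothness_of_isRCLikeNormedField]; exact WithTop.coe_le_coe.2 le_top)
  have hd : ∀ v : ℂ, DifferentiableAt ℝ (fun z => fderiv ℝ F z v) z := fun v =>
    (hF.fderiv_apply_const hU v).differentiableAt_of_isOpen hU hz
  have hdd : DifferentiableAt ℝ (fderiv ℝ F) z :=
    (hF.fderiv_of_isOpen hU (m := ∞) (by simp)).differentiableOn (by simp) |>.differentiableAt
      (hU.mem_nhds hz)
  have h2 : ∀ v w : ℂ, fderiv ℝ (fun z => fderiv ℝ F z v) z w = fderiv ℝ (fderiv ℝ F) z w v :=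
    fun v w => by
      rw [fderiv_clm_apply hdd (differentiableAt_const v)]; simp
  have hm : fderiv ℝ (wirt F) z = (1 / 2 : ℂ) • (fderiv ℝ (fun z => fderiv ℝ F z 1) z -
      Complex.I • fderiv ℝ (fun z => fderiv ℝ F z Complex.I) z) := by
    unfold wirt
    rw [fderiv_fun_const_smul ((hd 1).fun_sub ((hd _).fun_const_smul _)),
      fderiv_fun_sub (hd 1) ((hd _).fun_const_smul _), fderiv_fun_const_smul (hd _)]
  have hp : fderiv ℝ (wirtBar F) z = (1 / 2 : ℂ) • (fderiv ℝ (fun z => fderiv ℝ F z 1) z +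
      Complex.I • fderiv ℝ (fun z => fderiv ℝ F z Complex.I) z) := by
    unfold wirtBar
    rw [fderiv_fun_const_smul ((hd 1).fun_add ((hd _).fun_const_smul _)),
      fderiv_fun_add (hd 1) ((hd _).fun_const_smul _), fderiv_fun_const_smul (hd _)]
  rw [wirtBar, wirt, hm, hp]
  simp only [smul_apply, sub_apply,
    add_apply, h2, hsymm Complex.I 1]
  module

end Smooth

end Wirtinger

/-! ### Conformal lifts and their frames -/

section Lifts

variable {m : ℕ} {s : ℕ} {U : Set ℂ} {z : ℂ}

theorem pform_wirt_of_const {F G : ℂ → Fin m → ℂ} {a : ℂ} (hU : IsOpen U)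
    (hF : ContDiffOn ℝ ∞ F U) (hG : ContDiffOn ℝ ∞ G U) (h : ∀ w ∈ U, pform s (F w) (G w) = a)
    (hz : z ∈ U) : pform s (wirt F z) (G z) + pform s (F z) (wirt G z) = 0 := by
  rw [← wirt_pform s (hF.differentiableAt_of_isOpen hU hz) (hG.differentiableAt_of_isOpen hU hz),
    wirt_congr hU h hz, wirt_const]

theorem pform_wirtBar_of_const {F G : ℂ → Fin m → ℂ} {a : ℂ} (hU : IsOpen U)
    (hF : ContDiffOn ℝ ∞ F U) (hG : ContDiffOn ℝ ∞ G U) (h : ∀ w ∈ U, pform s (F w) (G w) = a)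
    (hz : z ∈ U) : pform s (wirtBar F z) (G z) + pform s (F z) (wirtBar G z) = 0 := by
  rw [← wirtBar_pform s (hF.differentiableAt_of_isOpen hU hz)
    (hG.differentiableAt_of_isOpen hU hz), wirtBar_congr hU h hz, wirtBar_const]

theorem ContDiffOn.derZ {Y : ℂ → Fin m → ℝ} (hY : ContDiffOn ℝ ∞ Y U) (hU : IsOpen U) :
    ContDiffOn ℝ ∞ (derZ Y) U :=
  hY.cplx.wirt hU

theorem derZbar_eq_star (Y : ℂ → Fin m → ℝ) (z : ℂ) : derZbar Y z = star (derZ Y z) := by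
  have := wirtBar_star (fun w => cplx (Y w)) z
  simp only [star_cplx] at this
  exact this

theorem wirtBar_cplx (Y : ℂ → Fin m → ℝ) (z : ℂ) :
    wirtBar (fun w => cplx (Y w)) z = star (derZ Y z) :=
  derZbar_eq_star Y z

theorem wirt_star_derZ {Y : ℂ → Fin m → ℝ} (hY : ContDiffOn ℝ ∞ Y U) (hU : IsOpen U)
    (hz : z ∈ U) : wirt (fun w => star (derZ Y w)) z = derZZbar Y z := by
  have h := wirtBar_wirt_comm hY.cplx hU hz
  simp only [← wirtBar_cplx]
  exact h.symm

theorem star_derZZbar {Y : ℂ → Fin m → ℝ} (hY : ContDiffOn ℝ ∞ Y U) (hU : IsOpen U)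
    (hz : z ∈ U) : star (derZZbar Y z) = derZZbar Y z :=
  (wirt_star (derZ Y) z).symm.trans (wirt_star_derZ hY hU hz)

theorem cplx_fderiv {Y : ℂ → Fin m → ℝ} (hY : DifferentiableAt ℝ Y z) (v : ℂ) :
    cplx (fderiv ℝ Y z v) = v • derZ Y z + star v • star (derZ Y z) := by
  have h : fderiv ℝ (fun w => cplx (Y w)) z v = cplx (fderiv ℝ Y z v) := by
    let L : (Fin m → ℝ) →L[ℝ] (Fin m → ℂ) :=
      ContinuousLinearMap.pi fun i => Complex.ofRealCLM.comp (ContinuousLinearMap.proj i)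
    have hL : HasFDerivAt (fun w => L (Y w)) (L.comp (fderiv ℝ Y z)) z :=
      L.hasFDerivAt.comp z hY.hasFDerivAt
    exact congrArg (fun A : ℂ →L[ℝ] (Fin m → ℂ) => A v) hL.fderiv
  rw [← h, fderiv_eq_wirt, wirtBar_cplx]
  rfl

theorem derZ_eq_fderiv {Y : ℂ → Fin m → ℝ} (hY : DifferentiableAt ℝ Y z) :
    derZ Y z = (1 / 2 : ℂ) • (cplx (fderiv ℝ Y z 1)
      - Complex.I • cplx (fderiv ℝ Y z Complex.I)) := by
  rw [cplx_fderiv hY, cplx_fderiv hY]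
  have hI := Complex.I_mul_I
  simp only [Complex.star_def, map_one, Complex.conj_I]
  match_scalars
  · linear_combination (1 / 2 : ℂ) * hI
  · linear_combination (-1 / 2 : ℂ) * hI

theorem pform_fderiv {Y : ℂ → Fin m → ℝ} (hY : DifferentiableAt ℝ Y z) (v : ℂ) :
    ((pform s (fderiv ℝ Y z v) (fderiv ℝ Y z v) : ℝ) : ℂ) =
      v ^ 2 * pform s (derZ Y z) (derZ Y z)
      + 2 * (v * star v) * pform s (derZ Y z) (star (derZ Y z))
      + star v ^ 2 * star (pform s (derZ Y z) (derZ Y z)) := by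
  rw [← pform_cplx, cplx_fderiv hY, star_pform]
  simp only [pform_add_left, pform_add_right, pform_smul_left, pform_smul_right,
    pform_comm s (star (derZ Y z)) (derZ Y z)]
  ring

/-- The conditions `⟨Y_z, Y_z⟩ = 0` and `⟨Y_z, Y_z̄⟩ = k / 2` express `|dY|² = k |dz|²`. -/
theorem pform_fderiv_of_conformal {Y : ℂ → Fin m → ℝ} (hY : DifferentiableAt ℝ Y z) {k : ℝ}
    (h0 : pform s (derZ Y z) (derZ Y z) = 0)
    (h1 : pform s (derZ Y z) (star (derZ Y z)) = k / 2) (v : ℂ) :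
    pform s (fderiv ℝ Y z v) (fderiv ℝ Y z v) = k * ‖v‖ ^ 2 := by
  have h := pform_fderiv (s := s) hY v
  rw [h0, h1, Complex.star_def, Complex.mul_conj'] at h
  apply Complex.ofReal_injective
  rw [h]; push_cast; simp; ring

theorem conformal_of_pform_fderiv {Y : ℂ → Fin m → ℝ} (hY : DifferentiableAt ℝ Y z)
    (h : ∀ v : ℂ, pform s (fderiv ℝ Y z v) (fderiv ℝ Y z v) = ‖v‖ ^ 2) :
    pform s (derZ Y z) (derZ Y z) = 0 ∧ pform s (derZ Y z) (star (derZ Y z)) = 1 / 2 := by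
  have key : ∀ v : ℂ, v * star v = v ^ 2 * pform s (derZ Y z) (derZ Y z)
      + 2 * (v * star v) * pform s (derZ Y z) (star (derZ Y z))
      + star v ^ 2 * star (pform s (derZ Y z) (derZ Y z)) := fun v => by
    rw [← pform_fderiv hY v, h v, Complex.star_def, Complex.mul_conj']
    push_cast; rfl
  -- Three directions suffice to determine the quadratic form.
  have k1 := key 1
  have k2 := key Complex.I
  have k3 := key (1 + Complex.I)
  simp only [Complex.star_def, map_one, Complex.conj_I, map_add] at k1 k2 k3
  have hI := Complex.I_mul_I
  generalize pform s (derZ Y z) (derZ Y z) = A at *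
  generalize pform s (derZ Y z) (star (derZ Y z)) = B at *
  generalize (starRingEnd ℂ) A = A' at *
  have e2 : 1 = -A + 2 * B - A' := by
    linear_combination k2 + (1 + A - 2 * B + A') * hI
  have e3 : 2 = 2 * Complex.I * A + 4 * B - 2 * Complex.I * A' := by
    linear_combination k3 + (1 + A - 2 * B + A') * hI
  have hB : B = 1 / 2 := by linear_combination (-1 / 4 : ℂ) * k1 - (1 / 4 : ℂ) * e2
  have e4 : Complex.I * (A - A') = 0 := by linear_combination (-1 / 2 : ℂ) * e3 - 2 * hB
  have e5 : A - A' = 0 := (mul_eq_zero.1 e4).resolve_left Complex.I_ne_zero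
  exact ⟨by linear_combination (-1 / 2 : ℂ) * k1 - hB + (1 / 2 : ℂ) * e5, hB⟩

theorem isSpacelikeImmersionAt_iff_of_conformal {Y : ℂ → Fin m → ℝ}
    (hY : DifferentiableAt ℝ Y z) {k : ℝ} (h0 : pform s (derZ Y z) (derZ Y z) = 0)
    (h1 : pform s (derZ Y z) (star (derZ Y z)) = k / 2) :
    IsSpacelikeImmersionAt s Y z ↔ 0 < k := by
  constructor
  · intro h
    have := h 1 one_ne_zero
    rwa [pform_fderiv_of_conformal hY h0 h1, norm_one, one_pow, mul_one] at this
  · intro hk v hv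
    rw [pform_fderiv_of_conformal hY h0 h1]
    have := norm_pos_iff.2 hv
    positivity

/-- A vector is conformally normal exactly when it is orthogonal to the complex frame
`Y, Y_z, Y_zz̄`; orthogonality to `Y_z̄` follows by conjugation. -/
theorem isConfNormal_iff {Y : ℂ → Fin m → ℝ} (hY : ContDiffOn ℝ ∞ Y U) (hU : IsOpen U)
    (hz : z ∈ U) (x : Fin m → ℝ) :
    IsConfNormal s Y z x ↔ pform s (cplx x) (cplx (Y z)) = 0 ∧ pform s (cplx x) (derZ Y z) = 0 ∧
      pform s (cplx x) (derZZbar Y z) = 0 := by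
  have hk := star_derZZbar hY hU hz
  constructor
  · intro h
    have h' : ∀ w ∈ confTangent Y z, pform s (cplx x) (cplx w) = 0 := fun w hw => by
      rw [pform_cplx, h w hw, Complex.ofReal_zero]
    have hr := h' (rePart (derZ Y z)) (Submodule.subset_span (by simp))
    have hi := h' (imPart (derZ Y z)) (Submodule.subset_span (by simp))
    have hd := h' (rePart (derZZbar Y z)) (Submodule.subset_span (by simp))
    rw [cplx_rePart_of_star_eq hk] at hd
    refine ⟨h' _ (Submodule.subset_span (by simp)), ?_, hd⟩
    rw [cplx_rePart, pform_smul_right, pform_add_right] at hr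
    rw [cplx_imPart, pform_smul_right, pform_sub_right] at hi
    have hi' := (mul_eq_zero.1 hi).resolve_left (by simp)
    linear_combination hr + (1 / 2 : ℂ) * hi'
  · rintro ⟨h0, h1, h2⟩ w hw
    have h1b : pform s (cplx x) (star (derZ Y z)) = 0 := by
      rw [← star_cplx, ← star_pform, h1, star_zero]
    apply Complex.ofReal_injective
    rw [← pform_cplx, Complex.ofReal_zero]
    induction hw using Submodule.span_induction with
    | mem w hw =>
      simp only [Set.mem_insert_iff, Set.mem_singleton_iff] at hw
      rcases hw with rfl | rfl | rfl | rfl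
      · exact h0
      · rw [cplx_rePart, pform_smul_right, pform_add_right, h1, h1b]; simp
      · rw [cplx_imPart, pform_smul_right, pform_sub_right, h1, h1b]; simp
      · rw [cplx_rePart_of_star_eq hk, h2]
    | zero =>
      rw [pform_cplx, pform_zero_right, Complex.ofReal_zero]
    | add a b _ _ ha hb => rw [cplx_add, pform_add_right, ha, hb, add_zero]
    | smul a b _ hb => rw [cplx_smul, pform_smul_right, hb, mul_zero]

/-- The complexification of `V` is contained in the complex span of `Y, Y_z, Y_z̄, Y_zz̄`. -/
theorem exists_cplx_eq_of_mem_confTangent {Y : ℂ → Fin m → ℝ} (hY : ContDiffOn ℝ ∞ Y U)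
    (hU : IsOpen U) (hz : z ∈ U) {w : Fin m → ℝ} (hw : w ∈ confTangent Y z) :
    ∃ a b b' d : ℂ, cplx w = a • cplx (Y z) + b • derZ Y z + b' • star (derZ Y z)
      + d • derZZbar Y z := by
  simp only [confTangent, Submodule.mem_span_insert, Submodule.mem_span_singleton] at hw
  obtain ⟨a, _, ⟨b, _, ⟨c, _, ⟨d, rfl⟩, rfl⟩, rfl⟩, rfl⟩ := hw
  refine ⟨a, b / 2 - c * (Complex.I / 2), b / 2 + c * (Complex.I / 2), d, ?_⟩
  simp only [cplx_add, cplx_smul, cplx_rePart_of_star_eq (star_derZZbar hY hU hz)]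
  rw [cplx_rePart, cplx_imPart]
  module

/-- If `ψ_z` is a combination of `Y` and `Y_z̄`, then `dψ` takes values in `V`. -/
theorem fderiv_mem_confTangent {Y ψ : ℂ → Fin m → ℝ} (hψ : DifferentiableAt ℝ ψ z) {a b : ℂ}
    (h : derZ ψ z = a • cplx (Y z) + b • star (derZ Y z)) (v : ℂ) :
    fderiv ℝ ψ z v ∈ confTangent Y z := by
  have h2 : fderiv ℝ ψ z v = (2 * (v * a).re) • Y z + (2 * (v * b).re) • rePart (derZ Y z)
      + (2 * (v * b).im) • imPart (derZ Y z) := by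
    apply cplx_injective
    rw [cplx_fderiv hψ, h]
    simp only [cplx_add, cplx_smul, cplx_rePart, cplx_imPart]
    have ha : ((2 * (v * a).re : ℝ) : ℂ) = v * a + star v * star a := by
      rw [← star_mul', Complex.star_def, Complex.add_conj]
    have hb : ((2 * (v * b).re : ℝ) : ℂ) = v * b + star v * star b := by
      rw [← star_mul', Complex.star_def, Complex.add_conj]
    have hc : ((2 * (v * b).im : ℝ) : ℂ) * Complex.I = v * b - star v * star b := by
      rw [← star_mul', Complex.star_def, Complex.sub_conj]
    rw [ha, hb]
    simp only [star_add, star_smul, star_star, star_cplx, smul_smul, mul_neg]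
    rw [← mul_div_assoc _ Complex.I, hc]
    module
  rw [h2]
  refine add_mem (add_mem ?_ ?_) ?_ <;>
    exact Submodule.smul_mem _ _ (Submodule.subset_span (by simp))

namespace IsCanonicalLift

variable {Y : ℂ → Fin m → ℝ}

theorem differentiableAt (hY : IsCanonicalLift s U Y) (hU : IsOpen U) (hz : z ∈ U) :
    DifferentiableAt ℝ Y z :=
  hY.smooth.differentiableAt_of_isOpen hU hz

theorem pform_self (hY : IsCanonicalLift s U Y) (hz : z ∈ U) :
    pform s (cplx (Y z)) (cplx (Y z)) = 0 := by
  rw [pform_cplx, hY.null z hz, Complex.ofReal_zero]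

theorem pform_derZ_derZ (hY : IsCanonicalLift s U Y) (hU : IsOpen U) (hz : z ∈ U) :
    pform s (derZ Y z) (derZ Y z) = 0 :=
  (conformal_of_pform_fderiv (hY.differentiableAt hU hz) (hY.metric z hz)).1

theorem pform_derZ_star (hY : IsCanonicalLift s U Y) (hU : IsOpen U) (hz : z ∈ U) :
    pform s (derZ Y z) (star (derZ Y z)) = 1 / 2 :=
  (conformal_of_pform_fderiv (hY.differentiableAt hU hz) (hY.metric z hz)).2

theorem pform_star_star (hY : IsCanonicalLift s U Y) (hU : IsOpen U) (hz : z ∈ U) :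
    pform s (star (derZ Y z)) (star (derZ Y z)) = 0 := by
  rw [← star_pform, hY.pform_derZ_derZ hU hz, star_zero]

theorem pform_self_derZ (hY : IsCanonicalLift s U Y) (hU : IsOpen U) (hz : z ∈ U) :
    pform s (cplx (Y z)) (derZ Y z) = 0 := by
  have h := pform_wirt_of_const hU hY.smooth.cplx hY.smooth.cplx (fun w hw => hY.pform_self hw) hz
  change pform s (derZ Y z) _ + pform s _ (derZ Y z) = 0 at h
  rw [pform_comm s (derZ Y z)] at h
  linear_combination h / 2

theorem pform_self_star (hY : IsCanonicalLift s U Y) (hU : IsOpen U) (hz : z ∈ U) :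
    pform s (cplx (Y z)) (star (derZ Y z)) = 0 := by
  rw [← star_cplx, ← star_pform, hY.pform_self_derZ hU hz, star_zero]

theorem pform_self_derZZbar (hY : IsCanonicalLift s U Y) (hU : IsOpen U) (hz : z ∈ U) :
    pform s (cplx (Y z)) (derZZbar Y z) = -1 / 2 := by
  have h := pform_wirtBar_of_const hU hY.smooth.cplx (hY.smooth.derZ hU)
    (fun w hw => hY.pform_self_derZ hU hw) hz
  rw [wirtBar_cplx] at h
  change pform s (star (derZ Y z)) _ + pform s _ (derZZbar Y z) = 0 at h
  rw [pform_comm s (star (derZ Y z)), hY.pform_derZ_star hU hz] at h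
  linear_combination h

theorem pform_derZ_derZZbar (hY : IsCanonicalLift s U Y) (hU : IsOpen U) (hz : z ∈ U) :
    pform s (derZ Y z) (derZZbar Y z) = 0 := by
  have h := pform_wirtBar_of_const hU (hY.smooth.derZ hU) (hY.smooth.derZ hU)
    (fun w hw => hY.pform_derZ_derZ hU hw) hz
  change pform s (derZZbar Y z) _ + pform s _ (derZZbar Y z) = 0 at h
  rw [pform_comm s (derZZbar Y z)] at h
  linear_combination h / 2

theorem pform_star_derZZbar (hY : IsCanonicalLift s U Y) (hU : IsOpen U) (hz : z ∈ U) :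
    pform s (star (derZ Y z)) (derZZbar Y z) = 0 := by
  rw [← star_derZZbar hY.smooth hU hz, ← star_pform, hY.pform_derZ_derZZbar hU hz, star_zero]

theorem pform_derZZ_derZ (hY : IsCanonicalLift s U Y) (hU : IsOpen U) (hz : z ∈ U) :
    pform s (derZZ Y z) (derZ Y z) = 0 := by
  have h := pform_wirt_of_const hU (hY.smooth.derZ hU) (hY.smooth.derZ hU)
    (fun w hw => hY.pform_derZ_derZ hU hw) hz
  change pform s (derZZ Y z) _ + pform s _ (derZZ Y z) = 0 at h
  rw [pform_comm s (derZ Y z)] at h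
  linear_combination h / 2

theorem pform_derZZ_star (hY : IsCanonicalLift s U Y) (hU : IsOpen U) (hz : z ∈ U) :
    pform s (derZZ Y z) (star (derZ Y z)) = 0 := by
  have h := pform_wirt_of_const hU (hY.smooth.derZ hU) (hY.smooth.derZ hU).star
    (fun w hw => hY.pform_derZ_star hU hw) hz
  rw [wirt_star_derZ hY.smooth hU hz] at h
  change pform s (derZZ Y z) _ + _ = 0 at h
  linear_combination h - hY.pform_derZ_derZZbar hU hz

theorem pform_hopf_derZZbar (hY : IsCanonicalLift s U Y) (hU : IsOpen U) (hz : z ∈ U) :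
    pform s (hopf s Y z) (derZZbar Y z) = 0 := by
  rw [hopf, pform_add_left, pform_smul_left, hY.pform_self_derZZbar hU hz, schwarzian]
  ring

/-- The Hopf differential of a canonical lift is the only vector orthogonal to `Y_zz̄` that differs
from `Y_zz` by a multiple of `Y`, and `Y_zz̄` is real. So it is real as soon as some vector
`Y_zz - α Y` is. -/
theorem isIsothermicLift (hY : IsCanonicalLift s U Y) (hU : IsOpen U)
    (h : ∀ z ∈ U, ∃ α : ℂ, star (derZZ Y z - α • cplx (Y z)) = derZZ Y z - α • cplx (Y z)) :
    IsIsothermicLift s U Y := by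
  refine ⟨hY, fun z hz => imPart_eq_zero_iff.2 ?_⟩
  obtain ⟨α, hα⟩ := h z hz
  set R := derZZ Y z - α • cplx (Y z) with hR
  set β := α + schwarzian s Y z / 2 with hβ
  have hh : hopf s Y z = R + β • cplx (Y z) := by rw [hopf, hR, hβ]; module
  have h0 := hY.pform_hopf_derZZbar hU hz
  rw [hh, pform_add_left, pform_smul_left, hY.pform_self_derZZbar hU hz] at h0
  have hr : star (pform s R (derZZbar Y z)) = pform s R (derZZbar Y z) := by
    rw [star_pform, hα, star_derZZbar hY.smooth hU hz]
  have hβ1 : β = 2 * pform s R (derZZbar Y z) := by linear_combination -2 * h0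
  have hβ2 : star β = β := by rw [hβ1, star_mul', hr]; simp
  rw [hh, star_add, star_smul, hα, hβ2, star_cplx]

end IsCanonicalLift

theorem derZ_smul {t : ℂ → ℝ} {Ψ : ℂ → Fin m → ℝ} (ht : DifferentiableAt ℝ t z)
    (hΨ : DifferentiableAt ℝ Ψ z) :
    derZ (fun w => t w • Ψ w) z
      = wirt (fun w => (t w : ℂ)) z • cplx (Ψ z) + (t z : ℂ) • derZ Ψ z := by
  have hc : DifferentiableAt ℝ (fun w => cplx (Ψ w)) z :=
    differentiableAt_pi.2 fun i =>
      Complex.ofRealCLM.differentiableAt.comp z (differentiableAt_pi.1 hΨ i)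
  have := wirt_smul (Complex.ofRealCLM.differentiableAt.comp z ht) hc
  simp only [← cplx_smul, Function.comp_def, Complex.ofRealCLM_apply] at this
  exact this

/-- Rescaling a lift of a conformal map into the light cone rescales the induced metric: the
derivative of the factor contributes nothing, because `⟨Ψ, Ψ⟩ = 0` and `⟨Ψ, Ψ_z⟩ = 0`. -/
theorem conformal_smul {t : ℂ → ℝ} {Ψ : ℂ → Fin m → ℝ} {k : ℝ} (hU : IsOpen U) (hz : z ∈ U)
    (ht : DifferentiableAt ℝ t z) (hΨ : ContDiffOn ℝ ∞ Ψ U)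
    (hn : ∀ w ∈ U, pform s (Ψ w) (Ψ w) = 0) (h0 : pform s (derZ Ψ z) (derZ Ψ z) = 0)
    (h1 : pform s (derZ Ψ z) (star (derZ Ψ z)) = k / 2) :
    pform s (derZ (fun w => t w • Ψ w) z) (derZ (fun w => t w • Ψ w) z) = 0 ∧
    pform s (derZ (fun w => t w • Ψ w) z) (star (derZ (fun w => t w • Ψ w) z))
      = (t z ^ 2 * k : ℝ) / 2 := by
  have hc : ∀ w ∈ U, pform s (cplx (Ψ w)) (cplx (Ψ w)) = 0 := fun w hw => by
    rw [pform_cplx, hn w hw, Complex.ofReal_zero]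
  have h := pform_wirt_of_const hU hΨ.cplx hΨ.cplx hc hz
  change pform s (derZ Ψ z) _ + pform s _ (derZ Ψ z) = 0 at h
  have h2 : pform s (cplx (Ψ z)) (derZ Ψ z) = 0 := by
    rw [pform_comm s (derZ Ψ z)] at h
    linear_combination h / 2
  have h3 : pform s (cplx (Ψ z)) (star (derZ Ψ z)) = 0 := by
    rw [← star_cplx, ← star_pform, h2, star_zero]
  have h4 : star (t z : ℂ) = t z := Complex.conj_ofReal _
  rw [derZ_smul ht (hΨ.differentiableAt_of_isOpen hU hz)]
  simp only [star_add, star_smul, star_cplx, h4, pform_add_left, pform_add_right, pform_smul_left,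
    pform_smul_right, pform_comm s (derZ Ψ z) (cplx (Ψ z)), h2, h3, hc z hz, h0, h1]
  constructor
  · ring
  · push_cast; ring

end Lifts

/-! ### Rescaled lifts that form a Darboux pair -/

section

variable {m : ℕ} {s : ℕ} {U : Set ℂ} {z : ℂ}

theorem wirtBar_ofReal (f : ℂ → ℝ) (z : ℂ) :
    wirtBar (fun w => (f w : ℂ)) z = star (wirt (fun w => (f w : ℂ)) z) := by
  have := wirtBar_star (fun w => (f w : ℂ)) z
  simp only [Complex.star_def, Complex.conj_ofReal] at this
  exact this

/-- The mixed second derivative of a real function is real. -/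
theorem star_wirt_star_wirt_ofReal {f : ℂ → ℝ} (hf : ContDiffOn ℝ ∞ f U) (hU : IsOpen U)
    (hz : z ∈ U) : star (wirt (fun w => star (wirt (fun w => (f w : ℂ)) w)) z)
      = wirt (fun w => star (wirt (fun w => (f w : ℂ)) w)) z := by
  have h : wirtBar (fun w => (f w : ℂ)) = fun w => star (wirt (fun w => (f w : ℂ)) w) :=
    funext (wirtBar_ofReal f)
  have h1 := wirtBar_wirt_comm hf.ofReal hU hz
  rw [h] at h1
  calc _ = wirtBar (wirt fun w => (f w : ℂ)) z := by rw [wirt_star, star_star]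
    _ = _ := h1

/-- A map `Ψ` into the light cone with `Ψ_z = 2 p_z̄ Y - 2 p Y_z̄` is isothermic, and `Ψ / (2 p)` is
its canonical lift. -/
theorem isIsothermicLift_of_polar {W : Set ℂ} (hW : IsOpen W) {Y Ψ : ℂ → Fin m → ℝ} {p : ℂ → ℝ}
    (hY : ContDiffOn ℝ ∞ Y W) (hΨ : ContDiffOn ℝ ∞ Ψ W) (hp : ContDiffOn ℝ ∞ p W)
    (hp0 : ∀ z ∈ W, p z ≠ 0) (hΨ0 : ∀ z ∈ W, Ψ z ≠ 0) (hn : ∀ z ∈ W, pform s (Ψ z) (Ψ z) = 0)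
    (hc0 : ∀ z ∈ W, pform s (derZ Ψ z) (derZ Ψ z) = 0)
    (hc1 : ∀ z ∈ W, pform s (derZ Ψ z) (star (derZ Ψ z)) = (4 * p z ^ 2 : ℝ) / 2)
    (hΨz : ∀ z ∈ W, derZ Ψ z = (2 * star (wirt (fun w => (p w : ℂ)) z)) • cplx (Y z)
      - (2 * (p z : ℂ)) • star (derZ Y z)) :
    IsIsothermicLift s W (fun z => (2 * p z)⁻¹ • Ψ z) := by
  have ht : ContDiffOn ℝ ∞ (fun z => (2 * p z)⁻¹) W :=
    (contDiffOn_const.mul hp).inv fun z hz => mul_ne_zero two_ne_zero (hp0 z hz)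
  have hΦ : ContDiffOn ℝ ∞ (fun z => (2 * p z)⁻¹ • Ψ z) W := ht.smul hΨ
  have hcan : IsCanonicalLift s W (fun z => (2 * p z)⁻¹ • Ψ z) := by
    refine ⟨hΦ, fun z hz => ?_, fun z hz => ?_, fun z hz v => ?_⟩
    · exact smul_ne_zero (inv_ne_zero (mul_ne_zero two_ne_zero (hp0 z hz))) (hΨ0 z hz)
    · rw [pform_smul_left, pform_smul_right, hn z hz]; simp
    · obtain ⟨h0, h1⟩ := conformal_smul hW hz (ht.differentiableAt_of_isOpen hW hz) hΨ hn
        (hc0 z hz) (hc1 z hz)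
      rw [pform_fderiv_of_conformal (hΦ.differentiableAt_of_isOpen hW hz) h0 h1]
      have := hp0 z hz
      field_simp
      ring
  refine hcan.isIsothermicLift hW fun z hz => ?_
  set P : ℂ → ℂ := fun w => (p w : ℂ) with hP
  set T : ℂ → ℂ := fun w => ((2 * p w)⁻¹ : ℝ) with hT
  have hPs : ContDiffOn ℝ ∞ P W := hp.ofReal
  have hTs : ContDiffOn ℝ ∞ T W := ht.ofReal
  have hPz := hPs.wirt hW
  have hTz := hTs.wirt hW
  have hPT : ∀ w ∈ W, P w * T w = 1 / 2 := fun w hw => by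
    have : (p w : ℂ) ≠ 0 := Complex.ofReal_ne_zero.2 (hp0 w hw)
    simp only [hP, hT]; push_cast; field_simp
  have hPTz : wirt P z * T z + P z * wirt T z = 0 := by
    rw [← wirt_mul (hPs.differentiableAt_of_isOpen hW hz) (hTs.differentiableAt_of_isOpen hW hz),
      wirt_congr hW hPT hz, wirt_const]
  have h1 : ∀ w ∈ W, derZ (fun z => (2 * p z)⁻¹ • Ψ z) w = wirt T w • cplx (Ψ w)
      + (2 * T w * star (wirt P w)) • cplx (Y w) - star (derZ Y w) := fun w hw => by
    rw [derZ_smul (ht.differentiableAt_of_isOpen hW hw) (hΨ.differentiableAt_of_isOpen hW hw),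
      hΨz w hw]
    have := hPT w hw
    change wirt T w • _ + T w • ((2 * star (wirt P w)) • _ - (2 * P w) • _) = _
    match_scalars
    · ring
    · ring
    · linear_combination (-2) * this
  have d {F : ℂ → ℂ} (hF : ContDiffOn ℝ ∞ F W) := hF.differentiableAt_of_isOpen hW hz
  have dv {F : ℂ → Fin m → ℂ} (hF : ContDiffOn ℝ ∞ F W) := hF.differentiableAt_of_isOpen hW hz
  have hc2 : ContDiffOn ℝ ∞ (fun w => 2 * T w * star (wirt P w)) W :=
    (contDiffOn_const.mul hTs).mul hPz.star
  have h2 : derZZ (fun z => (2 * p z)⁻¹ • Ψ z) z = wirt (wirt T) z • cplx (Ψ z)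
      + wirt T z • derZ Ψ z + ((2 * wirt T z * star (wirt P z)
        + 2 * T z * wirt (fun w => star (wirt P w)) z) • cplx (Y z)
      + (2 * T z * star (wirt P z)) • derZ Y z) - derZZbar Y z := by
    have s1 : ContDiffOn ℝ ∞ (fun w => wirt T w • cplx (Ψ w)) W := hTz.smul hΨ.cplx
    have s2 : ContDiffOn ℝ ∞ (fun w => (2 * T w * star (wirt P w)) • cplx (Y w)) W :=
      hc2.smul hY.cplx
    change wirt (derZ _) z = _
    rw [wirt_congr hW h1 hz, wirt_sub (dv (s1.add s2)) (dv (hY.derZ hW).star),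
      wirt_add (dv s1) (dv s2),
      wirt_smul (d hTz) (dv hΨ.cplx), wirt_smul (d hc2) (dv hY.cplx), wirt_star_derZ hY hW hz,
      wirt_mul (d (contDiffOn_const.mul hTs)) (d hPz.star),
      wirt_mul (d contDiffOn_const) (d hTs), wirt_const, zero_mul, zero_add]
    rfl
  have h3 := star_wirt_star_wirt_ofReal hp hW hz
  change star (wirt (fun w => star (wirt P w)) z) = wirt (fun w => star (wirt P w)) z at h3
  have hTst : star (T z) = T z := Complex.conj_ofReal _
  have hPst : star (P z) = P z := Complex.conj_ofReal _
  have hp0' : P z ≠ 0 := Complex.ofReal_ne_zero.2 (hp0 z hz)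
  -- `T_z = -2 T² P_z`, so the coefficient of `Y_z̄` below is conjugate to that of `Y_z`.
  have hTz2 : wirt T z = -2 * T z ^ 2 * wirt P z := by
    have := hPT z hz
    apply mul_left_cancel₀ hp0'
    linear_combination hPTz + 2 * T z * wirt P z * this
  -- The summand `T_zz Ψ` of the second derivative is this multiple of `T Ψ`, since `2 P T = 1`.
  refine ⟨2 * P z * wirt (wirt T) z, ?_⟩
  have h4 : derZZ (fun z => (2 * p z)⁻¹ • Ψ z) z
      - (2 * P z * wirt (wirt T) z) • cplx ((2 * p z)⁻¹ • Ψ z)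
      = (2 * T z * wirt (fun w => star (wirt P w)) z
          - 8 * T z ^ 2 * wirt P z * star (wirt P z)) • cplx (Y z)
        + (2 * T z * star (wirt P z)) • derZ Y z
        + (2 * T z * wirt P z) • star (derZ Y z) - derZZbar Y z := by
    have e := hPT z hz
    rw [h2, hΨz z hz, cplx_smul]
    change wirt (wirt T) z • cplx (Ψ z) + wirt T z • ((2 * star (wirt P z)) • cplx (Y z)
      - (2 * P z) • star (derZ Y z)) + _ - derZZbar Y z - _ • (T z • _) = _
    rw [hTz2]
    match_scalars
    · linear_combination (-2 * wirt (wirt T) z) * e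
    · ring
    · linear_combination (4 * T z * wirt P z) * e
    · ring
    · ring
  rw [h4]
  simp only [star_sub, star_add, star_smul, star_mul', star_star, star_cplx, h3, hTst,
    star_derZZbar hY hW hz, star_pow, star_ofNat]
  module

/-- The algebraic core of the permutability statement, for maps `Ψ`, `Ψs` into the light cone. The
lifts are scaled so that `Ψ / (2 p)` is canonical and the inner product of the two is `-1`. -/
theorem isDarbouxPair_of_polar {W : Set ℂ} (hW : IsOpen W) {Y Ys Ψ Ψs : ℂ → Fin m → ℝ}
    {p q : ℂ → ℝ} {μ : ℂ → ℂ} {θ : ℝ} (hθ : θ ≠ 0)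
    (hY : ContDiffOn ℝ ∞ Y W) (hΨ : ContDiffOn ℝ ∞ Ψ W) (hΨs : ContDiffOn ℝ ∞ Ψs W)
    (hp : ContDiffOn ℝ ∞ p W) (hq : ContDiffOn ℝ ∞ q W)
    (hp0 : ∀ z ∈ W, p z ≠ 0) (hq0 : ∀ z ∈ W, q z ≠ 0)
    (hn : ∀ z ∈ W, pform s (Ψ z) (Ψ z) = 0) (hns : ∀ z ∈ W, pform s (Ψs z) (Ψs z) = 0)
    (hnn : ∀ z ∈ W, pform s (Ψ z) (Ψs z) = 2 * p z * q z / θ)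
    (hc0 : ∀ z ∈ W, pform s (derZ Ψ z) (derZ Ψ z) = 0)
    (hc1 : ∀ z ∈ W, pform s (derZ Ψ z) (star (derZ Ψ z)) = (4 * p z ^ 2 : ℝ) / 2)
    (hcs0 : ∀ z ∈ W, pform s (derZ Ψs z) (derZ Ψs z) = 0)
    (hcs1 : ∀ z ∈ W, pform s (derZ Ψs z) (star (derZ Ψs z)) = (q z ^ 2 : ℝ) / 2)
    (hΨz : ∀ z ∈ W, derZ Ψ z = (2 * star (wirt (fun w => (p w : ℂ)) z)) • cplx (Y z)
      - (2 * (p z : ℂ)) • star (derZ Y z))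
    (hΨsz : ∀ z ∈ W, derZ Ψs z = (μ z * q z / 2) • cplx (Y z) + (q z : ℂ) • derZ Y z
      + ((2 * wirt (fun w => (p w : ℂ)) z + p z * μ z) / θ) • cplx (Ys z))
    (hqz : ∀ z ∈ W, wirt (fun w => (q w : ℂ)) z = μ z / 2 * q z - star (μ z) * p z
      - 2 * star (wirt (fun w => (p w : ℂ)) z))
    (hΨΨs : ∀ z ∈ W, Ψs z = Ψ z + q z • Y z + (2 * p z / θ) • Ys z) :
    IsDarbouxPair s W θ (fun z => (2 * p z)⁻¹ • Ψ z) (fun z => (-θ / q z) • Ψs z) := by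
  have hΨ0 : ∀ z ∈ W, Ψ z ≠ 0 := fun z hz h => by
    have h1 := hnn z hz
    rw [h, pform_zero_left] at h1
    exact div_ne_zero (mul_ne_zero (mul_ne_zero two_ne_zero (hp0 z hz)) (hq0 z hz)) hθ h1.symm
  have hτ : ContDiffOn ℝ ∞ (fun z => -θ / q z) W := contDiffOn_const.div hq hq0
  have ht : ContDiffOn ℝ ∞ (fun z => (2 * p z)⁻¹) W :=
    (contDiffOn_const.mul hp).inv fun z hz => mul_ne_zero two_ne_zero (hp0 z hz)
  have hΦs : ContDiffOn ℝ ∞ (fun z => (-θ / q z) • Ψs z) W := hτ.smul hΨs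
  refine ⟨isIsothermicLift_of_polar hW hY hΨ hp hp0 hΨ0 hn hc0 hc1 hΨz, hθ, hΦs,
    fun z hz => ?_, fun z hz => ?_, fun z hz => ?_, ?_⟩
  · rw [pform_smul_left, pform_smul_right, hns z hz]; simp
  · obtain ⟨h0, h1⟩ := conformal_smul hW hz (hτ.differentiableAt_of_isOpen hW hz) hΨs hns
      (hcs0 z hz) (hcs1 z hz)
    rw [isSpacelikeImmersionAt_iff_of_conformal (hΦs.differentiableAt_of_isOpen hW hz) h0 h1]
    have := hq0 z hz
    have : -θ / q z ≠ 0 := div_ne_zero (neg_ne_zero.2 hθ) this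
    positivity
  · have := hq0 z hz
    have := hp0 z hz
    rw [pform_smul_left, pform_smul_right, hnn z hz]
    field_simp
  · -- Half of this function is the coefficient of `Φ*` that remains in `Φ*_z` when `Ys` is
    -- expressed by `Ψ`, `Ψs` and `Y`; the equation for `q_z` gives it the symmetric form below.
    refine ⟨fun z => 2 * (wirt (fun w => (p w : ℂ)) z / p z
      + (star (μ z) * p z + 2 * star (wirt (fun w => (p w : ℂ)) z)) / q z), fun z hz => ?_⟩
    have hpc : (p z : ℂ) ≠ 0 := Complex.ofReal_ne_zero.2 (hp0 z hz)
    have hqc : (q z : ℂ) ≠ 0 := Complex.ofReal_ne_zero.2 (hq0 z hz)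
    have hθc : (θ : ℂ) ≠ 0 := Complex.ofReal_ne_zero.2 hθ
    have d {F : ℂ → ℂ} (hF : ContDiffOn ℝ ∞ F W) := hF.differentiableAt_of_isOpen hW hz
    have dr {F : ℂ → ℝ} (hF : ContDiffOn ℝ ∞ F W) := hF.differentiableAt_of_isOpen hW hz
    have dv {F : ℂ → Fin m → ℝ} (hF : ContDiffOn ℝ ∞ F W) := hF.differentiableAt_of_isOpen hW hz
    have hTz : wirt (fun w => ((2 * p w)⁻¹ : ℝ) : ℂ → ℂ) z
        = -wirt (fun w => (p w : ℂ)) z / (2 * p z ^ 2) := by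
      have e : ∀ w ∈ W, (p w : ℂ) * ((2 * p w)⁻¹ : ℝ) = 1 / 2 := fun w hw => by
        have : (p w : ℂ) ≠ 0 := Complex.ofReal_ne_zero.2 (hp0 w hw)
        push_cast; field_simp
      have e1 := wirt_mul (d hp.ofReal) (d ht.ofReal)
      rw [wirt_congr hW e hz, wirt_const] at e1
      push_cast at e1 ⊢
      field_simp at e1 ⊢
      linear_combination -e1
    have hτz : wirt (fun w => ((-θ / q w : ℝ) : ℂ)) z
        = θ * wirt (fun w => (q w : ℂ)) z / q z ^ 2 := by
      have e : ∀ w ∈ W, (q w : ℂ) * ((-θ / q w : ℝ) : ℂ) = -θ := fun w hw => by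
        have : (q w : ℂ) ≠ 0 := Complex.ofReal_ne_zero.2 (hq0 w hw)
        push_cast; field_simp
      have e1 := wirt_mul (d hq.ofReal) (d hτ.ofReal)
      rw [wirt_congr hW e hz, wirt_const] at e1
      push_cast at e1 ⊢
      field_simp at e1 ⊢
      linear_combination -e1
    rw [derZbar_eq_star, derZ_smul (dr hτ) (dv hΨs), derZ_smul (dr ht) (dv hΨ), hTz, hτz,
      hqz z hz, hΨsz z hz, hΨz z hz]
    simp only [hΨΨs z hz, cplx_add, cplx_smul, star_add, star_sub, star_smul, star_mul', star_star,
      star_cplx, star_div₀, star_neg, star_pow, star_ofNat, Complex.star_def, Complex.conj_ofReal,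
      map_mul, map_add, map_div₀, Complex.conj_conj, map_ofNat]
    push_cast
    generalize wirt (fun w => (p w : ℂ)) z = pz
    generalize (starRingEnd ℂ) pz = pzb
    generalize (starRingEnd ℂ) (μ z) = μb
    match_scalars <;> field_simp <;> ring

end

/-! ### Darboux transforms -/

section

variable {m : ℕ} {s : ℕ} {U : Set ℂ} {z : ℂ} {θ c : ℝ} {Y Ys ψ : ℂ → Fin m → ℝ}

/-- The function `μ` in the equation of a Darboux transform, recovered from the lifts:
`μ = 2 ⟨Y_z, Y*⟩`. -/
noncomputable def darbouxMu (s : ℕ) (Y Ys : ℂ → Fin m → ℝ) (z : ℂ) : ℂ :=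
  2 * pform s (derZ Y z) (cplx (Ys z))

theorem pform_derZ_right (Y Ys : ℂ → Fin m → ℝ) (z : ℂ) :
    pform s (cplx (Ys z)) (derZ Y z) = darbouxMu s Y Ys z / 2 := by
  rw [darbouxMu, pform_comm]; ring

theorem pform_star_right (Y Ys : ℂ → Fin m → ℝ) (z : ℂ) :
    pform s (cplx (Ys z)) (star (derZ Y z)) = star (darbouxMu s Y Ys z) / 2 := by
  rw [← star_cplx, ← star_pform, pform_derZ_right]; simp

namespace IsDarbouxPair

theorem null_cplx (hD : IsDarbouxPair s U θ Y Ys) (hz : z ∈ U) :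
    pform s (cplx (Ys z)) (cplx (Ys z)) = 0 := by
  rw [pform_cplx, hD.null z hz, Complex.ofReal_zero]

theorem normalized_cplx (hD : IsDarbouxPair s U θ Y Ys) (hz : z ∈ U) :
    pform s (cplx (Y z)) (cplx (Ys z)) = -1 := by
  rw [pform_cplx, hD.normalized z hz]; simp

theorem contDiffOn_darbouxMu (hD : IsDarbouxPair s U θ Y Ys) (hU : IsOpen U) :
    ContDiffOn ℝ ∞ (darbouxMu s Y Ys) U :=
  contDiffOn_const.mul
    ((hD.isothermic.canonical.smooth.derZ hU).pform_complex s hD.smooth.cplx)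

/-- Differentiating `⟨Y, Y*⟩ = -1` shows that the function `μ` in the definition is `2 ⟨Y_z, Y*⟩`;
in particular it is smooth. -/
theorem derZ_eq (hD : IsDarbouxPair s U θ Y Ys) (hU : IsOpen U) (hz : z ∈ U) :
    derZ Ys z = (darbouxMu s Y Ys z / 2) • cplx (Ys z)
      + (θ : ℂ) • (star (derZ Y z) + (star (darbouxMu s Y Ys z) / 2) • cplx (Y z)) := by
  have hY := hD.isothermic.canonical
  obtain ⟨μ, hμ⟩ := hD.derivative
  have h := hμ z hz
  rw [derZbar_eq_star] at h
  have h1 := pform_wirt_of_const hU hY.smooth.cplx hD.smooth.cplx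
    (fun w hw => hD.normalized_cplx hw) hz
  change pform s (derZ Y z) _ + pform s _ (derZ Ys z) = 0 at h1
  have h2 : μ z = darbouxMu s Y Ys z := by
    rw [h] at h1
    simp only [pform_add_right, pform_smul_right, hD.normalized_cplx hz, hY.pform_self hz,
      hY.pform_self_star hU hz] at h1
    rw [darbouxMu]
    linear_combination -2 * h1
  rw [← h2]
  exact h

theorem conformal (hD : IsDarbouxPair s U θ Y Ys) (hU : IsOpen U) (hz : z ∈ U) :
    pform s (derZ Ys z) (derZ Ys z) = 0 ∧
      pform s (derZ Ys z) (star (derZ Ys z)) = (θ ^ 2 : ℝ) / 2 := by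
  have hY := hD.isothermic.canonical
  have hθ : star (θ : ℂ) = θ := Complex.conj_ofReal _
  have h1 := hY.pform_self_derZ hU hz
  have h2 := hY.pform_self_star hU hz
  have h3 := hD.normalized_cplx hz
  rw [hD.derZ_eq hU hz]
  simp only [star_add, star_smul, star_cplx, hθ, star_star, star_div₀, star_ofNat, pform_add_left,
    pform_add_right, pform_smul_left, pform_smul_right, hD.null_cplx hz, hY.pform_self hz,
    pform_derZ_right Y Ys z, pform_star_right Y Ys z, h1, h2, h3, hY.pform_star_star hU hz,
    pform_comm s (star (derZ Y z)) (cplx (Ys z)), pform_comm s (cplx (Ys z)) (cplx (Y z)),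
    pform_comm s (star (derZ Y z)) (cplx (Y z)), pform_comm s (star (derZ Y z)) (derZ Y z),
    hY.pform_derZ_star hU hz]
  constructor
  · ring
  · push_cast; ring

/-- `μ_z̄ / 2 = ⟨Y_zz̄, Y*⟩ + |μ|² / 4` is real. -/
theorem star_wirtBar_darbouxMu (hD : IsDarbouxPair s U θ Y Ys) (hU : IsOpen U) (hz : z ∈ U) :
    star (wirtBar (darbouxMu s Y Ys) z) = wirtBar (darbouxMu s Y Ys) z := by
  have hY := hD.isothermic.canonical
  have hθ : star (θ : ℂ) = θ := Complex.conj_ofReal _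
  have hd := hY.smooth.derZ hU
  have h1 : wirtBar (darbouxMu s Y Ys) z
      = 2 * (pform s (derZZbar Y z) (cplx (Ys z))
        + star (darbouxMu s Y Ys z) * darbouxMu s Y Ys z / 4) +
        θ * (2 * pform s (derZ Y z) (derZ Y z)) := by
    have e : wirtBar (fun w => (2 : ℂ) * pform s (derZ Y w) (cplx (Ys w))) z = _ :=
      wirtBar_mul (differentiableAt_const _)
        ((hd.pform_complex s hD.smooth.cplx).differentiableAt_of_isOpen hU hz)
    rw [wirtBar_const, wirtBar_pform s (hd.differentiableAt_of_isOpen hU hz)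
      (hD.smooth.cplx.differentiableAt_of_isOpen hU hz), wirtBar_cplx, hD.derZ_eq hU hz] at e
    simp only [star_add, star_smul, star_cplx, hθ, star_star, star_div₀, star_ofNat,
      pform_add_right, pform_smul_right, pform_comm s (derZ Y z) (cplx (Ys z)),
      pform_derZ_right Y Ys z, pform_comm s (derZ Y z) (cplx (Y z)), hY.pform_self_derZ hU hz] at e
    refine Eq.trans e ?_
    change 0 * _ + 2 * (pform s (derZZbar Y z) _ + _) = _
    ring
  rw [h1, hY.pform_derZ_derZ hU hz]
  simp only [star_add, star_mul', star_pform, star_cplx, star_star, star_div₀, star_ofNat,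
    star_derZZbar hY.smooth hU hz, mul_zero, star_zero]
  ring

/-- A Darboux transform is again isothermic, with the same adapted coordinate. Its canonical lift
is `Y* / |θ|`. -/
theorem isIsothermicLift (hD : IsDarbouxPair s U θ Y Ys) (hU : IsOpen U) :
    IsIsothermicLift s U (fun z => |θ|⁻¹ • Ys z) := by
  have hY := hD.isothermic.canonical
  have hθ0 := abs_pos.2 hD.theta_ne_zero
  have hs : ContDiffOn ℝ ∞ (fun z => |θ|⁻¹ • Ys z) U := hD.smooth.const_smul _
  have hcan : IsCanonicalLift s U (fun z => |θ|⁻¹ • Ys z) := by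
    refine ⟨hs, fun z hz => smul_ne_zero (inv_ne_zero hθ0.ne') fun h => ?_, fun z hz => ?_,
      fun z hz v => ?_⟩
    · have := hD.normalized z hz
      rw [h, pform_zero_right] at this
      norm_num at this
    · rw [pform_smul_left, pform_smul_right, hD.null z hz]; simp
    · obtain ⟨h0, h1⟩ := conformal_smul (t := fun _ => |θ|⁻¹) hU hz (differentiableAt_const _)
        hD.smooth hD.null (hD.conformal hU hz).1 (hD.conformal hU hz).2
      rw [pform_fderiv_of_conformal (hs.differentiableAt_of_isOpen hU hz) h0 h1, inv_pow, sq_abs,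
        inv_mul_cancel₀ (pow_ne_zero 2 hD.theta_ne_zero), one_mul]
  refine hcan.isIsothermicLift hU fun z hz => ?_
  set μ := darbouxMu s Y Ys with hμ
  have hμs : ContDiffOn ℝ ∞ μ U := hD.contDiffOn_darbouxMu hU
  have hYs := hY.smooth.cplx
  have hYz := hY.smooth.derZ hU
  have dm {F : ℂ → ℂ} (hF : ContDiffOn ℝ ∞ F U) := hF.differentiableAt_of_isOpen hU hz
  have dv {F : ℂ → Fin m → ℂ} (hF : ContDiffOn ℝ ∞ F U) := hF.differentiableAt_of_isOpen hU hz
  have hθ : star (θ : ℂ) = θ := Complex.conj_ofReal _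
  have ha : star ((|θ|⁻¹ : ℝ) : ℂ) = (|θ|⁻¹ : ℝ) := Complex.conj_ofReal _
  have h1 : ∀ w ∈ U, derZ (fun z => |θ|⁻¹ • Ys z) w = ((|θ|⁻¹ : ℝ) : ℂ) •
      ((1 / 2 : ℂ) • μ w • cplx (Ys w) + (θ : ℂ) • (star (derZ Y w)
        + (1 / 2 : ℂ) • star (μ w) • cplx (Y w))) := fun w hw => by
    have e := derZ_smul (t := fun _ => |θ|⁻¹) (differentiableAt_const _)
      (hD.smooth.differentiableAt_of_isOpen hU hw)
    rw [e, wirt_const, zero_smul, zero_add, hD.derZ_eq hU hw]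
    module
  have s1 : ContDiffOn ℝ ∞ (fun w => μ w • cplx (Ys w)) U := hμs.smul hD.smooth.cplx
  have s2 : ContDiffOn ℝ ∞ (fun w => star (μ w) • cplx (Y w)) U := hμs.star.smul hYs
  have s1' : ContDiffOn ℝ ∞ (fun w => (1 / 2 : ℂ) • μ w • cplx (Ys w)) U := s1.const_smul _
  have s2' : ContDiffOn ℝ ∞ (fun w => (1 / 2 : ℂ) • star (μ w) • cplx (Y w)) U := s2.const_smul _
  have s3 : ContDiffOn ℝ ∞ (fun w => star (derZ Y w) + (1 / 2 : ℂ) • star (μ w) • cplx (Y w)) U :=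
    hYz.star.add s2'
  have s3' : ContDiffOn ℝ ∞ (fun w => (θ : ℂ) • (star (derZ Y w)
      + (1 / 2 : ℂ) • star (μ w) • cplx (Y w))) U := s3.const_smul _
  have wc (a : ℂ) {F : ℂ → Fin m → ℂ} (hF : ContDiffOn ℝ ∞ F U) :
      wirt (fun w => a • F w) z = a • wirt F z := by
    have e := wirt_smul (f := fun _ => a) (differentiableAt_const _) (dv hF)
    rw [e, wirt_const, zero_smul, zero_add]
  have h2 : derZZ (fun z => |θ|⁻¹ • Ys z) z = ((|θ|⁻¹ : ℝ) : ℂ) •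
      ((1 / 2 : ℂ) • (wirt μ z • cplx (Ys z) + μ z • derZ Ys z) + (θ : ℂ) • (derZZbar Y z
        + (1 / 2 : ℂ) • (star (wirtBar μ z) • cplx (Y z) + star (μ z) • derZ Y z))) := by
    change wirt (derZ _) z = _
    rw [wirt_congr hU h1 hz, wc _ (s1'.add s3'), wirt_add (dv s1') (dv s3'), wc _ s1, wc _ s3,
      wirt_add (dv hYz.star) (dv s2'), wc _ s2, wirt_smul (dm hμs) (dv hD.smooth.cplx),
      wirt_smul (dm hμs.star) (dv hYs), wirt_star_derZ hY.smooth hU hz, wirt_star]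
    rfl
  -- This is the coefficient of `Y*` in `Y*_zz`; all other terms combine to a real vector.
  refine ⟨wirt μ z / 2 + μ z ^ 2 / 4, ?_⟩
  have h3 : derZZ (fun z => |θ|⁻¹ • Ys z) z
      - (wirt μ z / 2 + μ z ^ 2 / 4) • cplx (|θ|⁻¹ • Ys z) = (((|θ|⁻¹ : ℝ) : ℂ) * θ) •
      (derZZbar Y z + (1 / 2 : ℂ) • (μ z • star (derZ Y z) + star (μ z) • derZ Y z)
        + ((μ z * star (μ z)) / 4 + wirtBar μ z / 2) • cplx (Y z)) := by
    rw [h2, hD.derZ_eq hU hz, cplx_smul, hD.star_wirtBar_darbouxMu hU hz]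
    module
  rw [h3]
  simp only [star_add, star_smul, star_mul', star_star, star_cplx, star_div₀, star_ofNat, hθ, ha,
    star_derZZbar hY.smooth hU hz, hμ, hD.star_wirtBar_darbouxMu hU hz, star_one]
  module

end IsDarbouxPair

/-! ### Polar surfaces -/

/-- The coefficient `⟨ψ, κ⟩` of a section of the conformal normal bundle of an isothermic
surface; it is a real function, since `κ` is real. -/
noncomputable def hopfCoeff (s : ℕ) (Y ψ : ℂ → Fin m → ℝ) (z : ℂ) : ℝ :=
  pform s (ψ z) (rePart (hopf s Y z))

namespace IsPolarSurface

theorem pform_self_derZ_derZZbar (hψ : IsPolarSurface s U Y c ψ) (hU : IsOpen U) (hz : z ∈ U) :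
    pform s (cplx (ψ z)) (cplx (Y z)) = 0 ∧ pform s (cplx (ψ z)) (derZ Y z) = 0 ∧
      pform s (cplx (ψ z)) (derZZbar Y z) = 0 :=
  (isConfNormal_iff hψ.smooth_lift hU hz _).1 (hψ.normal z hz)

theorem pform_star (hψ : IsPolarSurface s U Y c ψ) (hU : IsOpen U) (hz : z ∈ U) :
    pform s (cplx (ψ z)) (star (derZ Y z)) = 0 := by
  rw [← star_cplx, ← star_pform, (hψ.pform_self_derZ_derZZbar hU hz).2.1, star_zero]

theorem hopfCoeff_eq (hY : IsIsothermicLift s U Y) (hψ : IsPolarSurface s U Y c ψ) (hU : IsOpen U)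
    (hz : z ∈ U) : (hopfCoeff s Y ψ z : ℂ) = pform s (cplx (ψ z)) (derZZ Y z) := by
  rw [hopfCoeff, ← pform_cplx, cplx_rePart_of_star_eq (imPart_eq_zero_iff.1 (hY.hopf_real z hz)),
    hopf, pform_add_right, pform_smul_right, (hψ.pform_self_derZ_derZZbar hU hz).1, mul_zero,
    add_zero]

theorem contDiffOn_hopfCoeff (hY : IsIsothermicLift s U Y) (hψ : IsPolarSurface s U Y c ψ)
    (hU : IsOpen U) : ContDiffOn ℝ ∞ (hopfCoeff s Y ψ) U := by
  have h : ContDiffOn ℝ ∞ (fun z => (pform s (cplx (ψ z)) (derZZ Y z)).re) U :=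
    Complex.reCLM.contDiff.comp_contDiffOn
      (hψ.smooth.cplx.pform_complex s ((hψ.smooth_lift.derZ hU).wirt hU))
  refine h.congr fun z hz => ?_
  rw [← hψ.hopfCoeff_eq hY hU hz, Complex.ofReal_re]

/-- The derivative of a parallel section of the conformal normal bundle. Orthogonality relations
determine all of its coefficients with respect to the frame of `V` except the one of `Y`, which
follows from `ψ_zz̄` being real. -/
theorem derZ_eq (hY : IsIsothermicLift s U Y) (hψ : IsPolarSurface s U Y c ψ) (hU : IsOpen U)
    (hz : z ∈ U) :
    derZ ψ z = (2 * star (wirt (fun w => (hopfCoeff s Y ψ w : ℂ)) z)) • cplx (Y z)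
      - (2 * (hopfCoeff s Y ψ z : ℂ)) • star (derZ Y z) := by
  have hc := hY.canonical
  have hp := hψ.contDiffOn_hopfCoeff hY hU
  have hYz := hc.smooth.derZ hU
  set a : ℂ → ℂ := fun w => -2 * pform s (derZ ψ w) (derZZbar Y w) with ha
  have has : ContDiffOn ℝ ∞ a U :=
    contDiffOn_const.mul ((hψ.smooth.derZ hU).pform_complex s (hYz.wirtBar hU))
  have h1 : ∀ w ∈ U, derZ ψ w = a w • cplx (Y w)
      - (2 * (hopfCoeff s Y ψ w : ℂ)) • star (derZ Y w) := fun w hw => by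
    obtain ⟨a₁, b₁, b₁', d₁, e₁⟩ :=
      exists_cplx_eq_of_mem_confTangent hc.smooth hU hw (hψ.parallel w hw 1)
    obtain ⟨a₂, b₂, b₂', d₂, e₂⟩ :=
      exists_cplx_eq_of_mem_confTangent hc.smooth hU hw (hψ.parallel w hw Complex.I)
    obtain ⟨A, B, B', D, e⟩ : ∃ A B B' D : ℂ, derZ ψ w = A • cplx (Y w) + B • derZ Y w
        + B' • star (derZ Y w) + D • derZZbar Y w := by
      refine ⟨1 / 2 * (a₁ - Complex.I * a₂), 1 / 2 * (b₁ - Complex.I * b₂),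
        1 / 2 * (b₁' - Complex.I * b₂'), 1 / 2 * (d₁ - Complex.I * d₂), ?_⟩
      rw [derZ_eq_fderiv (hψ.smooth.differentiableAt_of_isOpen hU hw), e₁, e₂]
      module
    have f0 := pform_wirt_of_const hU hψ.smooth.cplx hc.smooth.cplx
      (fun w hw => (hψ.pform_self_derZ_derZZbar hU hw).1) hw
    have f1 := pform_wirt_of_const hU hψ.smooth.cplx hYz
      (fun w hw => (hψ.pform_self_derZ_derZZbar hU hw).2.1) hw
    have f2 := pform_wirt_of_const hU hψ.smooth.cplx hYz.star
      (fun w hw => hψ.pform_star hU hw) hw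
    rw [wirt_star_derZ hc.smooth hU hw, (hψ.pform_self_derZ_derZZbar hU hw).2.2] at f2
    change pform s (derZ ψ w) _ + pform s _ (derZ Y w) = 0 at f0
    change pform s (derZ ψ w) _ + pform s _ (derZZ Y w) = 0 at f1
    change pform s (derZ ψ w) _ + 0 = 0 at f2
    rw [(hψ.pform_self_derZ_derZZbar hU hw).2.1] at f0
    rw [← hψ.hopfCoeff_eq hY hU hw] at f1
    have haw : a w = -2 * pform s (derZ ψ w) (derZZbar Y w) := rfl
    rw [e] at f0 f1 f2 haw
    simp only [pform_add_left, pform_smul_left, hc.pform_self hw, hc.pform_self_derZ hU hw,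
      hc.pform_self_star hU hw, hc.pform_self_derZZbar hU hw, hc.pform_derZ_derZ hU hw,
      hc.pform_derZ_star hU hw, hc.pform_star_star hU hw, hc.pform_derZ_derZZbar hU hw,
      hc.pform_star_derZZbar hU hw, pform_comm s (derZZbar Y w) (cplx (Y w)),
      pform_comm s (derZZbar Y w) (derZ Y w), pform_comm s (derZZbar Y w) (star (derZ Y w)),
      pform_comm s (derZ Y w) (cplx (Y w)), pform_comm s (star (derZ Y w)) (cplx (Y w)),
      pform_comm s (star (derZ Y w)) (derZ Y w)] at f0 f1 f2 haw
    -- Pairing with `Y`, `Y_z̄`, `Y_z` and `Y_zz̄` isolates the coefficients one after the other.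
    have hD : D = 0 := by linear_combination -2 * f0
    have hB : B = 0 := by linear_combination 2 * f2
    have hB' : B' = -2 * hopfCoeff s Y ψ w := by linear_combination 2 * f1
    rw [hD] at haw
    have hA : A = a w := by linear_combination -haw
    rw [e, hA, hB, hB', hD]
    module
  have d {F : ℂ → ℂ} (hF : ContDiffOn ℝ ∞ F U) := hF.differentiableAt_of_isOpen hU hz
  have dv {F : ℂ → Fin m → ℂ} (hF : ContDiffOn ℝ ∞ F U) := hF.differentiableAt_of_isOpen hU hz
  have s0 : ContDiffOn ℝ ∞ (fun w => 2 * (hopfCoeff s Y ψ w : ℂ)) U :=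
    contDiffOn_const.mul hp.ofReal
  have s1 : ContDiffOn ℝ ∞ (fun w => a w • cplx (Y w)) U := has.smul hc.smooth.cplx
  have s2 : ContDiffOn ℝ ∞ (fun w => (2 * (hopfCoeff s Y ψ w : ℂ)) • star (derZ Y w)) U :=
    s0.smul hYz.star
  have h2 : derZZbar ψ z = (wirtBar a z • cplx (Y z) + a z • star (derZ Y z))
      - ((2 * star (wirt (fun w => (hopfCoeff s Y ψ w : ℂ)) z)) • star (derZ Y z)
        + (2 * (hopfCoeff s Y ψ z : ℂ)) • star (derZZ Y z)) := by
    change wirtBar (derZ ψ) z = _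
    rw [wirtBar_congr hU h1 hz, wirtBar_sub (dv s1) (dv s2),
      wirtBar_smul (d has) (dv hc.smooth.cplx), wirtBar_smul (d s0) (dv hYz.star),
      wirtBar_mul (differentiableAt_const _) (d hp.ofReal), wirtBar_const, wirtBar_cplx,
      wirtBar_star, wirtBar_ofReal, zero_mul, zero_add]
    rfl
  have g1 : pform s (star (derZZ Y z)) (star (derZ Y z)) = 0 := by
    rw [← star_pform, hc.pform_derZZ_derZ hU hz, star_zero]
  have g2 : pform s (star (derZZ Y z)) (derZ Y z) = 0 := by
    rw [← star_star (derZ Y z), ← star_pform, hc.pform_derZZ_star hU hz, star_zero]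
  -- `⟨ψ_zz̄, Y_z̄⟩ = 0` is automatic; its conjugate `⟨ψ_zz̄, Y_z⟩ = 0` determines `a`.
  have k1 : pform s (derZZbar ψ z) (star (derZ Y z)) = 0 := by
    rw [h2]
    simp only [pform_sub_left, pform_add_left, pform_smul_left, g1, hc.pform_self_star hU hz,
      hc.pform_star_star hU hz]
    ring
  have k2 : pform s (derZZbar ψ z) (derZ Y z) = 0 := by
    rw [← star_derZZbar hψ.smooth hU hz, ← star_star (derZ Y z), ← star_pform, k1, star_zero]
  rw [h2] at k2
  simp only [pform_sub_left, pform_add_left, pform_smul_left, g2, hc.pform_self_derZ hU hz,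
    pform_comm s (star (derZ Y z)) (derZ Y z), hc.pform_derZ_star hU hz] at k2
  have k3 : a z = 2 * star (wirt (fun w => (hopfCoeff s Y ψ w : ℂ)) z) := by
    linear_combination 2 * k2
  rw [h1 z hz, k3]

theorem conformal (hY : IsIsothermicLift s U Y) (hψ : IsPolarSurface s U Y c ψ) (hU : IsOpen U)
    (hz : z ∈ U) : pform s (derZ ψ z) (derZ ψ z) = 0 ∧
      pform s (derZ ψ z) (star (derZ ψ z)) = (4 * hopfCoeff s Y ψ z ^ 2 : ℝ) / 2 := by
  have hc := hY.canonical
  have hr : star (hopfCoeff s Y ψ z : ℂ) = hopfCoeff s Y ψ z := Complex.conj_ofReal _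
  rw [hψ.derZ_eq hY hU hz]
  simp only [star_sub, star_smul, star_mul', star_cplx, star_star, star_ofNat, hr, pform_sub_left,
    pform_sub_right, pform_smul_left, pform_smul_right, hc.pform_self hz,
    hc.pform_self_derZ hU hz, hc.pform_self_star hU hz, hc.pform_star_star hU hz,
    hc.pform_derZ_star hU hz, pform_comm s (star (derZ Y z)) (derZ Y z),
    pform_comm s (star (derZ Y z)) (cplx (Y z))]
  constructor
  · ring
  · push_cast; ring

theorem hopfCoeff_ne_zero (hY : IsIsothermicLift s U Y) (hψ : IsPolarSurface s U Y c ψ)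
    (hU : IsOpen U) (hz : z ∈ U) (hnd : IsSpacelikeImmersionAt s ψ z) :
    hopfCoeff s Y ψ z ≠ 0 := by
  obtain ⟨h0, h1⟩ := hψ.conformal hY hU hz
  rw [isSpacelikeImmersionAt_iff_of_conformal (hψ.smooth.differentiableAt_of_isOpen hU hz) h0 h1]
    at hnd
  intro h
  rw [h] at hnd
  norm_num at hnd

end IsPolarSurface

end

/-! ### The transform of a polar surface -/

section

variable {m : ℕ} {s : ℕ} {U : Set ℂ} {z : ℂ} {θ c : ℝ} {Y Ys ψ : ℂ → Fin m → ℝ}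

/-- The transform `ψ* = ψ + ⟨ψ, Y*⟩ Y + (2 ⟨ψ, κ⟩ / θ) Y*` of a polar surface `ψ` of `[Y]`. Since
`ψ` is a section of `V^⊥`, the coefficient `⟨ψ, Y*⟩` depends only on the `V^⊥`-component of `Y*`. -/
noncomputable def polarTransform (s : ℕ) (θ : ℝ) (Y Ys ψ : ℂ → Fin m → ℝ) (z : ℂ) : Fin m → ℝ :=
  ψ z + pform s (ψ z) (Ys z) • Y z + (2 * hopfCoeff s Y ψ z / θ) • Ys z

theorem cplx_polarTransform (z : ℂ) : cplx (polarTransform s θ Y Ys ψ z) = cplx (ψ z)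
    + ((pform s (ψ z) (Ys z) : ℝ) : ℂ) • cplx (Y z)
    + (2 * (hopfCoeff s Y ψ z : ℂ) / θ) • cplx (Ys z) := by
  simp only [polarTransform, cplx_add, cplx_smul]
  push_cast
  rfl

namespace IsPolarSurface

theorem pform_polarTransform_right (hψ : IsPolarSurface s U Y c ψ) (hz : z ∈ U) :
    pform s (ψ z) (polarTransform s θ Y Ys ψ z)
      = c + 2 * hopfCoeff s Y ψ z * pform s (ψ z) (Ys z) / θ := by
  have h0 : pform s (ψ z) (Y z) = 0 := hψ.normal z hz _ (Submodule.subset_span (by simp))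
  simp only [polarTransform, pform_add_right, pform_smul_right, hψ.length z hz, h0]
  ring

end IsPolarSurface

namespace IsDarbouxPair

theorem wirt_pform_polar (hD : IsDarbouxPair s U θ Y Ys) (hψ : IsPolarSurface s U Y c ψ)
    (hU : IsOpen U) (hz : z ∈ U) :
    wirt (fun w => ((pform s (ψ w) (Ys w) : ℝ) : ℂ)) z
      = darbouxMu s Y Ys z / 2 * ((pform s (ψ z) (Ys z) : ℝ) : ℂ)
        - star (darbouxMu s Y Ys z) * hopfCoeff s Y ψ z
        - 2 * star (wirt (fun w => (hopfCoeff s Y ψ w : ℂ)) z) := by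
  simp only [← pform_cplx]
  rw [wirt_pform s (hψ.smooth.cplx.differentiableAt_of_isOpen hU hz)
    (hD.smooth.cplx.differentiableAt_of_isOpen hU hz)]
  change pform s (derZ ψ z) _ + pform s _ (derZ Ys z) = _
  rw [hψ.derZ_eq hD.isothermic hU hz, hD.derZ_eq hU hz]
  simp only [pform_sub_left, pform_smul_left, pform_add_right, pform_smul_right,
    hD.normalized_cplx hz, (hψ.pform_self_derZ_derZZbar hU hz).1, hψ.pform_star hU hz,
    pform_comm s (star (derZ Y z)) (cplx (Ys z)), pform_star_right Y Ys z]
  ring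

theorem contDiffOn_polarTransform (hD : IsDarbouxPair s U θ Y Ys) (hψ : IsPolarSurface s U Y c ψ)
    (hU : IsOpen U) : ContDiffOn ℝ ∞ (polarTransform s θ Y Ys ψ) U :=
  (hψ.smooth.add ((hψ.smooth.pform_real s hD.smooth).smul hψ.smooth_lift)).add
    (((contDiffOn_const.mul (hψ.contDiffOn_hopfCoeff hD.isothermic hU)).div_const θ).smul
      hD.smooth)

theorem derZ_polarTransform (hD : IsDarbouxPair s U θ Y Ys) (hψ : IsPolarSurface s U Y c ψ)
    (hU : IsOpen U) (hz : z ∈ U) :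
    derZ (polarTransform s θ Y Ys ψ) z
      = (darbouxMu s Y Ys z * ((pform s (ψ z) (Ys z) : ℝ) : ℂ) / 2) • cplx (Y z)
        + ((pform s (ψ z) (Ys z) : ℝ) : ℂ) • derZ Y z
        + ((2 * wirt (fun w => (hopfCoeff s Y ψ w : ℂ)) z
          + hopfCoeff s Y ψ z * darbouxMu s Y Ys z) / θ) • cplx (Ys z) := by
  have hp := (hψ.contDiffOn_hopfCoeff hD.isothermic hU).ofReal
  have hq := (hψ.smooth.pform_real s hD.smooth).ofReal
  have hθ : (θ : ℂ) ≠ 0 := Complex.ofReal_ne_zero.2 hD.theta_ne_zero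
  have d {F : ℂ → ℂ} (hF : ContDiffOn ℝ ∞ F U) := hF.differentiableAt_of_isOpen hU hz
  have dv {F : ℂ → Fin m → ℂ} (hF : ContDiffOn ℝ ∞ F U) := hF.differentiableAt_of_isOpen hU hz
  have s1 : ContDiffOn ℝ ∞ (fun w => ((pform s (ψ w) (Ys w) : ℝ) : ℂ) • cplx (Y w)) U :=
    hq.smul hψ.smooth_lift.cplx
  have s2' : ContDiffOn ℝ ∞ (fun w => (2 / θ : ℂ) * (hopfCoeff s Y ψ w : ℂ)) U :=
    contDiffOn_const.mul hp
  have s2 : ContDiffOn ℝ ∞ (fun w => ((2 / θ : ℂ) * (hopfCoeff s Y ψ w : ℂ)) • cplx (Ys w)) U :=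
    s2'.smul hD.smooth.cplx
  have e : ∀ w, cplx (polarTransform s θ Y Ys ψ w) = cplx (ψ w)
      + ((pform s (ψ w) (Ys w) : ℝ) : ℂ) • cplx (Y w)
      + ((2 / θ : ℂ) * (hopfCoeff s Y ψ w : ℂ)) • cplx (Ys w) := fun w => by
    rw [cplx_polarTransform]; module
  change wirt (fun w => cplx (polarTransform s θ Y Ys ψ w)) z = _
  rw [wirt_congr hU (fun w _ => e w) hz, wirt_add (dv (hψ.smooth.cplx.add s1)) (dv s2),
    wirt_add (dv hψ.smooth.cplx) (dv s1), wirt_smul (d hq) (dv hψ.smooth_lift.cplx),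
    wirt_smul (d s2') (dv hD.smooth.cplx), wirt_mul (differentiableAt_const _) (d hp), wirt_const,
    hD.wirt_pform_polar hψ hU hz]
  change derZ ψ z + (_ + _ • derZ Y z) + (_ + _ • derZ Ys z) = _
  rw [hψ.derZ_eq hD.isothermic hU hz, hD.derZ_eq hU hz]
  match_scalars <;> field_simp <;> ring

theorem conformal_polarTransform (hD : IsDarbouxPair s U θ Y Ys) (hψ : IsPolarSurface s U Y c ψ)
    (hU : IsOpen U) (hz : z ∈ U) :
    pform s (derZ (polarTransform s θ Y Ys ψ) z) (derZ (polarTransform s θ Y Ys ψ) z) = 0 ∧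
      pform s (derZ (polarTransform s θ Y Ys ψ) z) (star (derZ (polarTransform s θ Y Ys ψ) z))
        = (pform s (ψ z) (Ys z) ^ 2 : ℝ) / 2 := by
  have hc := hD.isothermic.canonical
  have hr (x : ℝ) : star (x : ℂ) = x := Complex.conj_ofReal _
  rw [hD.derZ_polarTransform hψ hU hz]
  simp only [star_add, star_smul, star_mul', star_cplx, star_ofNat, star_div₀, hr,
    pform_add_left, pform_add_right, pform_smul_left, pform_smul_right, hc.pform_self hz,
    hc.pform_self_derZ hU hz, hc.pform_self_star hU hz, hc.pform_derZ_derZ hU hz,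
    hc.pform_derZ_star hU hz, hD.null_cplx hz, hD.normalized_cplx hz,
    pform_comm s (cplx (Ys z)) (cplx (Y z)), pform_comm s (derZ Y z) (cplx (Y z)),
    pform_comm s (derZ Y z) (cplx (Ys z)), pform_derZ_right Y Ys z, pform_star_right Y Ys z]
  constructor
  · ring
  · push_cast; ring

theorem isSpacelikeImmersionAt_polarTransform (hD : IsDarbouxPair s U θ Y Ys)
    (hψ : IsPolarSurface s U Y c ψ) (hU : IsOpen U) (hz : z ∈ U) :
    IsSpacelikeImmersionAt s (polarTransform s θ Y Ys ψ) z ↔ pform s (ψ z) (Ys z) ≠ 0 := by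
  obtain ⟨h0, h1⟩ := hD.conformal_polarTransform hψ hU hz
  rw [isSpacelikeImmersionAt_iff_of_conformal
    ((hD.contDiffOn_polarTransform hψ hU).differentiableAt_of_isOpen hU hz) h0 h1]
  exact sq_pos_iff

theorem pform_polarTransform_self (hD : IsDarbouxPair s U θ Y Ys)
    (hψ : IsPolarSurface s U Y c ψ) (hz : z ∈ U) :
    pform s (polarTransform s θ Y Ys ψ z) (polarTransform s θ Y Ys ψ z) = c := by
  have h0 : pform s (ψ z) (Y z) = 0 := hψ.normal z hz _ (Submodule.subset_span (by simp))
  simp only [polarTransform, pform_add_left, pform_add_right, pform_smul_left, pform_smul_right,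
    hψ.length z hz, pform_comm s (Y z) (ψ z), pform_comm s (Ys z) (ψ z), h0,
    hD.isothermic.canonical.null z hz, hD.null z hz, hD.normalized z hz,
    pform_comm s (Ys z) (Y z)]
  ring

/-- The transform of a polar surface is a polar surface of the Darboux transform. It is parallel
because `ψ*_z` is a combination of `Y*` and `Y*_z̄`. -/
theorem isPolarSurface_polarTransform (hD : IsDarbouxPair s U θ Y Ys)
    (hψ : IsPolarSurface s U Y c ψ) (hU : IsOpen U)
    (hnd : ∀ z ∈ U, IsSpacelikeImmersionAt s ψ z) :
    IsPolarSurface s U Ys c (polarTransform s θ Y Ys ψ) := by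
  have hc := hD.isothermic.canonical
  have hr (x : ℝ) : star (x : ℂ) = x := Complex.conj_ofReal _
  have hθ : (θ : ℂ) ≠ 0 := Complex.ofReal_ne_zero.2 hD.theta_ne_zero
  have hs := hD.contDiffOn_polarTransform hψ hU
  have hder : ∀ z ∈ U, ∃ b : ℂ, derZ (polarTransform s θ Y Ys ψ) z = b • cplx (Ys z)
      + (((pform s (ψ z) (Ys z) : ℝ) : ℂ) / θ) • star (derZ Ys z) := fun z hz => by
    refine ⟨(2 * wirt (fun w => (hopfCoeff s Y ψ w : ℂ)) z
          + hopfCoeff s Y ψ z * darbouxMu s Y Ys z) / θ - ((pform s (ψ z) (Ys z) : ℝ) : ℂ) / θ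
          * (star (darbouxMu s Y Ys z) / 2), ?_⟩
    rw [hD.derZ_polarTransform hψ hU hz, hD.derZ_eq hU hz]
    simp only [star_add, star_smul, star_cplx, hr, star_star, star_div₀, star_ofNat]
    match_scalars <;> field_simp
    ring
  have h0 : ∀ z ∈ U, pform s (cplx (polarTransform s θ Y Ys ψ z)) (cplx (Ys z)) = 0 :=
    fun z hz => by
      rw [cplx_polarTransform]
      simp only [pform_add_left, pform_smul_left, hD.normalized_cplx hz, hD.null_cplx hz,
        pform_cplx]
      ring
  have hYYs : ∀ z ∈ U, pform s (cplx (Ys z)) (derZ Ys z) = 0 := fun z hz => by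
    have h := pform_wirt_of_const hU hD.smooth.cplx hD.smooth.cplx (fun w hw => hD.null_cplx hw) hz
    change pform s (derZ Ys z) _ + pform s _ (derZ Ys z) = 0 at h
    rw [pform_comm s (derZ Ys z)] at h
    linear_combination h / 2
  -- Differentiating an orthogonality relation moves the derivative to `Y*`, because `ψ*_z` is a
  -- combination of `Y*` and `Y*_z̄`.
  have h1 : ∀ z ∈ U, pform s (cplx (polarTransform s θ Y Ys ψ z)) (derZ Ys z) = 0 :=
    fun z hz => by
      have h := pform_wirt_of_const hU hs.cplx hD.smooth.cplx h0 hz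
      change pform s (derZ _ z) _ + pform s _ (derZ Ys z) = 0 at h
      obtain ⟨b, hb⟩ := hder z hz
      have h2 : pform s (star (derZ Ys z)) (cplx (Ys z)) = 0 := by
        rw [← star_cplx, ← star_pform, pform_comm, hYYs z hz, star_zero]
      rw [hb, pform_add_left, pform_smul_left, pform_smul_left, hD.null_cplx hz, h2] at h
      linear_combination h
  refine ⟨hD.smooth, ⟨_, fun z _ => ⟨|θ|⁻¹, inv_ne_zero (abs_ne_zero.2 hD.theta_ne_zero), rfl⟩,
    hD.isIsothermicLift hU⟩, hs, fun z hz => ?_, fun z hz v => ?_, fun z hz => ?_,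
    fun _ z hz h => ?_⟩
  · refine (isConfNormal_iff hD.smooth hU hz _).2 ⟨h0 z hz, h1 z hz, ?_⟩
    have h := pform_wirtBar_of_const hU hs.cplx (hD.smooth.derZ hU) h1 hz
    obtain ⟨b, hb⟩ := hder z hz
    rw [wirtBar_cplx, hb] at h
    change _ + pform s _ (derZZbar Ys z) = 0 at h
    simp only [star_add, star_smul, star_cplx, star_star, pform_add_left, pform_smul_left,
      hYYs z hz, (hD.conformal hU hz).1] at h
    linear_combination h
  · obtain ⟨b, hb⟩ := hder z hz
    exact fderiv_mem_confTangent (hs.differentiableAt_of_isOpen hU hz) hb v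
  · exact hD.pform_polarTransform_self hψ hz
  · -- `⟨Y, ψ*⟩ = - 2 ⟨ψ, κ⟩ / θ`, and `⟨ψ, κ⟩` does not vanish where `ψ` is an immersion.
    have hYψ : pform s (Y z) (ψ z) = 0 := by
      rw [pform_comm]
      exact hψ.normal z hz _ (Submodule.subset_span (by simp))
    have h2 : pform s (Y z) (polarTransform s θ Y Ys ψ z) = 0 := by rw [h, pform_zero_right]
    simp only [polarTransform, pform_add_right, pform_smul_right, hYψ, hc.null z hz,
      hD.normalized z hz] at h2
    have h3 : 2 * hopfCoeff s Y ψ z / θ = 0 := by linear_combination -h2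
    exact div_ne_zero (mul_ne_zero two_ne_zero
      (hψ.hopfCoeff_ne_zero hD.isothermic hU hz (hnd z hz))) hD.theta_ne_zero h3

/-- The permutability statement in a form common to the three signs of `c`: after an isometric
embedding `x ↦ L x + e` of the quadric `⟨x, x⟩ = c` into a light cone, where `e` is a constant
vector orthogonal to the image of `L` with `⟨e, e⟩ = -c`, the surfaces `ψ` and `ψ*` form a Darboux
pair. `L'` is the complexification of `L`. -/
theorem isDarbouxTransform_embedding {M s' : ℕ} {W : Set ℂ} (hW : IsOpen W) (hWU : W ⊆ U)
    (hU : IsOpen U) (hD : IsDarbouxPair s U θ Y Ys) (hψ : IsPolarSurface s U Y c ψ)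
    (hnd : ∀ z ∈ U, IsSpacelikeImmersionAt s ψ z)
    (hq0 : ∀ z ∈ W, pform s (ψ z) (Ys z) ≠ 0)
    (L : (Fin m → ℝ) →ₗ[ℝ] (Fin M → ℝ)) (L' : (Fin m → ℂ) →ₗ[ℂ] (Fin M → ℂ))
    (e : Fin M → ℝ) (hL : ∀ x, cplx (L x) = L' (cplx x)) (hst : ∀ x, star (L' x) = L' (star x))
    (hiso : ∀ x y, pform s' (L' x) (L' y) = pform s x y) (hLe : ∀ x, pform s' (L x) e = 0)
    (hee : pform s' e e = -c) :
    IsDarbouxTransform s' W θ (fun z => L (ψ z) + e)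
      (fun z => L (polarTransform s θ Y Ys ψ z) + e) := by
  set Lc : (Fin m → ℝ) →L[ℝ] (Fin M → ℝ) := L.toContinuousLinearMap
  set Lc' : (Fin m → ℂ) →L[ℂ] (Fin M → ℂ) := L'.toContinuousLinearMap
  have hisoR : ∀ x y, pform s' (L x) (L y) = pform s x y := fun x y => by
    apply Complex.ofReal_injective
    rw [← pform_cplx, ← pform_cplx, hL, hL, hiso]
  have smL {F : ℂ → Fin m → ℝ} (hF : ContDiffOn ℝ ∞ F U) : ContDiffOn ℝ ∞ (fun z => L (F z)) W :=
    (Lc.contDiff.comp_contDiffOn hF).mono hWU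
  have dL {F : ℂ → Fin m → ℝ} (hF : ContDiffOn ℝ ∞ F U) {z : ℂ} (hz : z ∈ W) :
      derZ (fun z => L (F z)) z = L' (derZ F z) := by
    have h := wirt_clm Lc' (hF.cplx.differentiableAt_of_isOpen hU (hWU hz))
    change wirt (fun w => cplx (L (F w))) z = _
    simp only [hL]
    exact h
  have dLe {F : ℂ → Fin m → ℝ} (hF : ContDiffOn ℝ ∞ F U) {z : ℂ} (hz : z ∈ W) :
      derZ (fun z => L (F z) + e) z = L' (derZ F z) := by
    rw [← dL hF hz]
    change wirt (fun w => cplx (L (F w) + e)) z = _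
    simp only [cplx_add]
    rw [wirt_add ((smL hF).cplx.differentiableAt_of_isOpen hW hz) (differentiableAt_const _),
      wirt_const, add_zero]
    rfl
  have pe (x y : Fin m → ℝ) : pform s' (L x + e) (L y + e) = pform s x y - c := by
    simp only [pform_add_left, pform_add_right, hisoR, hLe, pform_comm s' e, hee]
    ring
  have hY := hD.isothermic
  have hs := hD.contDiffOn_polarTransform hψ hU
  have hp0 : ∀ z ∈ W, hopfCoeff s Y ψ z ≠ 0 := fun z hz =>
    hψ.hopfCoeff_ne_zero hY hU (hWU hz) (hnd z (hWU hz))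
  have hpair : IsDarbouxPair s' W θ
      (fun z => (2 * hopfCoeff s Y ψ z)⁻¹ • (L (ψ z) + e))
      (fun z => (-θ / pform s (ψ z) (Ys z)) • (L (polarTransform s θ Y Ys ψ z) + e)) := by
    refine isDarbouxPair_of_polar (Y := fun z => L (Y z)) (Ys := fun z => L (Ys z))
      (μ := darbouxMu s Y Ys) hW hD.theta_ne_zero (smL hψ.smooth_lift)
      ((smL hψ.smooth).add contDiffOn_const) ((smL hs).add contDiffOn_const)
      ((hψ.contDiffOn_hopfCoeff hY hU).mono hWU) ((hψ.smooth.pform_real s hD.smooth).mono hWU)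
      hp0 hq0 (fun z hz => ?_) (fun z hz => ?_) (fun z hz => ?_) (fun z hz => ?_)
      (fun z hz => ?_) (fun z hz => ?_) (fun z hz => ?_) (fun z hz => ?_) (fun z hz => ?_)
      (fun z hz => ?_) (fun z hz => ?_)
    · rw [pe, hψ.length z (hWU hz), sub_self]
    · rw [pe, hD.pform_polarTransform_self hψ (hWU hz), sub_self]
    · rw [pe, hψ.pform_polarTransform_right (hWU hz)]; ring
    · rw [dLe hψ.smooth hz, hiso, (hψ.conformal hY hU (hWU hz)).1]
    · rw [dLe hψ.smooth hz, hst, hiso, (hψ.conformal hY hU (hWU hz)).2]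
    · rw [dLe hs hz, hiso, (hD.conformal_polarTransform hψ hU (hWU hz)).1]
    · rw [dLe hs hz, hst, hiso, (hD.conformal_polarTransform hψ hU (hWU hz)).2]
    · rw [dLe hψ.smooth hz, dL hψ.smooth_lift hz, hψ.derZ_eq hY hU (hWU hz), hL, hst]
      simp only [map_sub, map_smul]
    · rw [dLe hs hz, dL hψ.smooth_lift hz, hD.derZ_polarTransform hψ hU (hWU hz), hL, hL]
      simp only [map_add, map_smul]
    · exact hD.wirt_pform_polar hψ hU (hWU hz)
    · simp only [polarTransform, map_add, map_smul]
      abel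
  exact ⟨_, _, fun z hz => ⟨_, inv_ne_zero (mul_ne_zero two_ne_zero (hp0 z hz)), rfl⟩,
    fun z hz => ⟨_, div_ne_zero (neg_ne_zero.2 hD.theta_ne_zero) (hq0 z hz), rfl⟩, hpair⟩

end IsDarbouxPair

/-! ### Embeddings of space forms into light cones -/

section Pad

variable (m) (R : Type*) [CommRing R]

/-- The inclusion `R^m → R^(m+1)` that appends a zero coordinate. -/
def padLast : (Fin m → R) →ₗ[R] (Fin (m + 1) → R) where
  toFun x := (Fin.snoc x 0 : Fin (m + 1) → R)
  map_add' x y := by ext j; refine Fin.lastCases ?_ (fun i => ?_) j <;> simp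
  map_smul' a x := by ext j; refine Fin.lastCases ?_ (fun i => ?_) j <;> simp

/-- The inclusion `R^m → R^(m+1)` that prepends a zero coordinate. -/
def padFirst : (Fin m → R) →ₗ[R] (Fin (m + 1) → R) where
  toFun x := (Fin.cons 0 x : Fin (m + 1) → R)
  map_add' x y := by ext j; refine Fin.cases ?_ (fun i => ?_) j <;> simp
  map_smul' a x := by ext j; refine Fin.cases ?_ (fun i => ?_) j <;> simp

variable {m R}

/-- The appended coordinate counts negatively. -/
theorem pform_snoc (s : ℕ) (x y : Fin m → R) (a b : R) :
    pform (s + 1) (Fin.snoc x a : Fin (m + 1) → R) (Fin.snoc y b : Fin (m + 1) → R)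
      = pform s x y - a * b := by
  simp only [pform, Fin.sum_univ_castSucc, Fin.snoc_castSucc, Fin.snoc_last, Fin.val_castSucc,
    Fin.val_last]
  have h (i : Fin m) : (i : ℕ) + (s + 1) < m + 1 ↔ (i : ℕ) + s < m := by omega
  simp only [h]
  rw [if_neg (by omega), sub_eq_add_neg]

/-- The prepended coordinate counts positively. -/
theorem pform_cons {s : ℕ} (hs : s ≤ m) (x y : Fin m → R) (a b : R) :
    pform s (Fin.cons a x : Fin (m + 1) → R) (Fin.cons b y : Fin (m + 1) → R)
      = a * b + pform s x y := by
  simp only [pform, Fin.sum_univ_succ, Fin.cons_zero, Fin.cons_succ, Fin.val_succ, Fin.val_zero]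
  have h (i : Fin m) : (i : ℕ) + 1 + s < m + 1 ↔ (i : ℕ) + s < m := by omega
  simp only [h]
  rw [if_pos (by omega)]

end Pad

namespace IsDarbouxPair

theorem isDarbouxTransformOfLength_polarTransform {W : Set ℂ} (hs : s ≤ m) (hW : IsOpen W)
    (hWU : W ⊆ U) (hU : IsOpen U) (hD : IsDarbouxPair s U θ Y Ys) (hψ : IsPolarSurface s U Y c ψ)
    (hnd : ∀ z ∈ U, IsSpacelikeImmersionAt s ψ z) (hq0 : ∀ z ∈ W, pform s (ψ z) (Ys z) ≠ 0) :
    IsDarbouxTransformOfLength s W θ c ψ (polarTransform s θ Y Ys ψ) := by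
  have emb {M s' : ℕ} := hD.isDarbouxTransform_embedding (M := M) (s' := s') hW hWU hU hψ hnd hq0
  refine ⟨fun hc => ?_, fun hc => ?_, fun hc => ?_⟩
  · have h := emb (s' := s) LinearMap.id LinearMap.id 0 (fun _ => rfl) (fun _ => rfl)
      (fun _ _ => rfl) (fun _ => pform_zero_right s _) (by rw [pform_zero_right, hc, neg_zero])
    simpa using h
  · have h := emb (s' := s + 1) (padLast m ℝ) (padLast m ℂ)
      (Fin.snoc 0 (Real.sqrt c) : Fin (m + 1) → ℝ)
      (fun x => by ext j; refine Fin.lastCases ?_ (fun i => ?_) j <;> simp [cplx, padLast])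
      (fun x => by ext j; refine Fin.lastCases ?_ (fun i => ?_) j <;> simp [padLast])
      (fun x y => (pform_snoc s x y 0 0).trans (by ring))
      (fun x => (pform_snoc s x 0 0 _).trans (by rw [pform_zero_right]; ring))
      ((pform_snoc s 0 0 _ _).trans (by
        rw [pform_zero_right, Real.mul_self_sqrt hc.le, zero_sub]))
    have e (x : Fin m → ℝ) : padLast m ℝ x + (Fin.snoc 0 (Real.sqrt c) : Fin (m + 1) → ℝ)
        = (Fin.snoc x (Real.sqrt c) : Fin (m + 1) → ℝ) := by
      ext j; refine Fin.lastCases ?_ (fun i => ?_) j <;> simp [padLast]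
    simpa only [e] using h
  · have h := emb (s' := s) (padFirst m ℝ) (padFirst m ℂ)
      (Fin.cons (Real.sqrt (-c)) 0 : Fin (m + 1) → ℝ)
      (fun x => by ext j; refine Fin.cases ?_ (fun i => ?_) j <;> simp [cplx, padFirst])
      (fun x => by ext j; refine Fin.cases ?_ (fun i => ?_) j <;> simp [padFirst])
      (fun x y => (pform_cons hs x y 0 0).trans (by ring))
      (fun x => (pform_cons hs x 0 0 _).trans (by rw [pform_zero_right]; ring))
      ((pform_cons hs 0 0 _ _).trans (by
        rw [pform_zero_right, Real.mul_self_sqrt (neg_nonneg.2 hc.le), add_zero]))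
    have e (x : Fin m → ℝ) : padFirst m ℝ x + (Fin.cons (Real.sqrt (-c)) 0 : Fin (m + 1) → ℝ)
        = (Fin.cons (Real.sqrt (-c)) x : Fin (m + 1) → ℝ) := by
      ext j; refine Fin.cases ?_ (fun i => ?_) j <;> simp [padFirst]
    simpa only [e] using h

end IsDarbouxPair

end

theorem mainTheorem4 (n r : ℕ) (hr : r + 2 ≤ n) (U : Set ℂ) (hU : IsOpen U)
    (Y Ystar ξ ψ : ℂ → Fin (n + 2) → ℝ) (θ c : ℝ)
    (hD : IsDarbouxPair (r + 1) U θ Y Ystar)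
    (hξ : ∀ z ∈ U, IsNormalComponent (r + 1) Y z (Ystar z) (ξ z))
    (hψ : IsPolarSurface (r + 1) U Y c ψ)
    (hnd : ∀ z ∈ U, IsSpacelikeImmersionAt (r + 1) ψ z) :
    ∃ ψstar : ℂ → Fin (n + 2) → ℝ,
      (∀ z ∈ U, ψstar z = ψ z + pform (r + 1) (ψ z) (ξ z) • Y z
        + (2 * pform (r + 1) (ψ z) (rePart (hopf (r + 1) Y z)) / θ) • Ystar z) ∧
      IsPolarSurface (r + 1) U Ystar c ψstar ∧
      (∀ z ∈ U, IsSpacelikeImmersionAt (r + 1) ψstar z ↔ pform (r + 1) (ψ z) (ξ z) ≠ 0) ∧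
      IsDarbouxTransformOfLength (r + 1) {z ∈ U | IsSpacelikeImmersionAt (r + 1) ψstar z} θ c
        ψ ψstar := by
  have hq : ∀ z ∈ U, pform (r + 1) (ψ z) (ξ z) = pform (r + 1) (ψ z) (Ystar z) := fun z hz => by
    have h := hψ.normal z hz _ (hξ z hz).2
    rw [pform_sub_right] at h
    exact (sub_eq_zero.1 h).symm
  have hiff : ∀ z ∈ U, IsSpacelikeImmersionAt (r + 1) (polarTransform (r + 1) θ Y Ystar ψ) z ↔
      pform (r + 1) (ψ z) (Ystar z) ≠ 0 := fun z hz =>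
    hD.isSpacelikeImmersionAt_polarTransform hψ hU hz
  have hW : IsOpen {z ∈ U |
      IsSpacelikeImmersionAt (r + 1) (polarTransform (r + 1) θ Y Ystar ψ) z} := by
    have h := (hψ.smooth.pform_real (r + 1) hD.smooth).continuousOn.isOpen_inter_preimage hU
      (isOpen_compl_singleton (x := (0 : ℝ)))
    convert h using 1
    ext z
    exact and_congr_right fun hz => hiff z hz
  refine ⟨polarTransform (r + 1) θ Y Ystar ψ, fun z hz => ?_,
    hD.isPolarSurface_polarTransform hψ hU hnd, fun z hz => ?_, ?_⟩
  · rw [hq z hz]; rfl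
  · rw [hq z hz]; exact hiff z hz
  · exact hD.isDarbouxTransformOfLength_polarTransform (by omega) hW (fun z hz => hz.1) hU hψ hnd
      fun z hz => (hiff z hz.1).1 hz.2
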